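/- Fix a countably infinite domain $\mathbf{Dom}$ of constants, named by binary words, and a finite relational schema $\Sigma$. An *instance* is a finite set of facts $R(c_1,\dots,c_n)$ with $R\in\Sigma$ of arity $n$ and $c_i\in\mathbf{Dom}$. A *query* $Q$ is a finite expression over a finite set of syntax symbols and the constants; it has an arity and assigns to each instance $\mathbf I$ a set $Q(\mathbf I)$ of tuples of constants of that arity; $\mathrm{adom}(Q)$ is the set of constants occurring in the expression $Q$. The query $Q$ is *generic* if $\rho(Q(\mathbf I))=Q(\rho(\mathbf I))$ for every instance $\mathbf I$ and every bijection $\rho:\mathbf{Dom}\to\mathbf{Dom}$ that fixes $\mathrm{adom}(Q)$ pointwise. An *update* of $\mathbf I$ is a pair $U=(\mathrm{Ins},\mathrm{Del})$ of finite sets of facts with $\mathrm{Ins}\cap\mathbf I=\emptyset$ and $\mathrm{Del}\subseteq\mathbf I$; its size is $|\mathrm{Ins}\cup\mathrm{Del}|$, and $\mathbf I_U=(\mathbf I\cup\mathrm{Ins})\setminus\mathrm{Del}$. It is a *repair* with respect to $\langle Q,\mathbf I,\bar a\rangle$ if $\bar a\in Q(\mathbf I_U)$. For a class $\mathcal L$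 of queries, let $\mathrm{Eval}^{\mathcal L}$ be the problem: given $\langle Q,\mathbf I,\bar a\rangle$ with $Q\in\mathcal L$ and $\bar a$ a tuple of constants whose length is the arity of $Q$, is $\bar a\in Q(\mathbf I)$? Let $\mathrm{MA}_{bound}^{\mathcal L}$ be the problem: given $\langle Q,\mathbf I,\bar a,k\rangle$ with $Q,\mathbf I,\bar a$ as before and $k\in\mathbb N$ in binary, is there a repair of size at most $k$ with respect to $\langle Q,\mathbf I,\bar a\rangle$? (The schema is fixed; the query is part of the input, and an instance is given by a list of its facts.) **Proposition.** Let $\mathcal L$ be a class of generic queries. If $\mathrm{Eval}^{\mathcal L}\in\mathrm{NEXP}=\bigcup_{p}\mathrm{NTIME}(2^{p(n)})$, then $\mathrm{MA}_{bound}^{\mathcal L}\in\mathrm{2NEXP}=\bigcup_{p}\mathrm{NTIME}(2^{2^{p(n)}})$, where $p$ ranges over the polynomials. -/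

import Mathlib

/-! ### Nondeterministic Turing machines and time classes -/

/-- A nondeterministic multi-stack Turing machine with input alphabet `A`: Mathlib's `TM2` machine
model with finitely many stacks (a work tape is a pair of stacks), finite stack alphabets, finitely
many labels and finitely many internal states, and with two transition functions `prog false` and
`prog true`. At every step the machine chooses freely which of the two it applies. -/
structure NTM (A : Type) where
  /-- index type of the stacks -/
  K : Type
  [decK : DecidableEq K]
  [finK : Fintype K]
  /-- stack alphabets -/
  Γ : K → Type
  [finΓ : ∀ k, Fintype (Γ k)]
  /-- labels -/
  Λ : Type
  [finΛ : Fintype Λ]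
  /-- internal states -/
  σ : Type
  [finσ : Fintype σ]
  /-- the stack that holds the input in the beginning; all other stacks are empty then -/
  inStack : K
  /-- how an input letter is written on the input stack -/
  inLetter : A ↪ Γ inStack
  /-- the initial label -/
  start : Λ
  /-- the initial internal state -/
  init : σ
  /-- the internal states in which halting means acceptance -/
  accept : Set σ
  /-- the two transition functions -/
  prog : Bool → Λ → Turing.TM2.Stmt Γ Λ σ

namespace NTM

variable {A : Type} (M : NTM A)

/-- Configurations: current label (`none` once halted), internal state, contents of the stacks. -/
abbrev Cfg : Type := Turing.TM2.Cfg M.Γ M.Λ M.σ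

/-- The initial configuration on the input word `w` (its first letter is on top of the stack). -/
def initial (w : List A) : M.Cfg where
  l := some M.start
  var := M.init
  stk := @Function.update M.K (fun k => List (M.Γ k)) M.decK (fun _ => []) M.inStack
    (w.map M.inLetter)

/-- `c'` is one of the (at most two) successor configurations of `c`. -/
def Step (c c' : M.Cfg) : Prop :=
  ∃ b : Bool, @Turing.TM2.step M.K M.Γ M.Λ M.σ M.decK (M.prog b) c = some c'

/-- `M.StepsTo t c c'`: some computation of exactly `t` steps leads from `c` to `c'`. -/
inductive StepsTo : ℕ → M.Cfg → M.Cfg → Prop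
  | refl (c : M.Cfg) : StepsTo 0 c c
  | head {t : ℕ} {c c' c'' : M.Cfg} : M.Step c c' → StepsTo t c' c'' → StepsTo (t + 1) c c''

/-- A halted configuration in an accepting internal state. -/
def Accepting (c : M.Cfg) : Prop := c.l = none ∧ c.var ∈ M.accept

/-- `M` has an accepting computation of exactly `t` steps on the input `w`. -/
def AcceptsIn (w : List A) (t : ℕ) : Prop :=
  ∃ c : M.Cfg, M.StepsTo t (M.initial w) c ∧ M.Accepting c

end NTM

/-- `NTIME T`: the languages `P` of the nondeterministic machines `M` that work in time `T`, that
is, `M` accepts (by some computation) exactly the words of `P`, and every `w ∈ P` has an accepting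
computation of at most `T |w|` steps. For time-constructible bounds, as those used below, it makes
no difference if one asks moreover that all computations stop in time, since a clock can be added
to `M`. -/
def NTIME {A : Type} (T : ℕ → ℕ) : Set (Language A) :=
  {P | ∃ M : NTM A,
    (∀ w t, M.AcceptsIn w t → w ∈ P) ∧ (∀ w ∈ P, ∃ t ≤ T w.length, M.AcceptsIn w t)}

/-- Nondeterministic time `2 ^ poly(n)`. -/
def NEXP {A : Type} : Set (Language A) :=
  {P | ∃ p : Polynomial ℕ, P ∈ NTIME fun n => 2 ^ p.eval n}

/-- Nondeterministic time `2 ^ 2 ^ poly(n)`. -/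
def TwoNEXP {A : Type} : Set (Language A) :=
  {P | ∃ p : Polynomial ℕ, P ∈ NTIME fun n => 2 ^ 2 ^ p.eval n}

/-! ### Databases, queries and updates -/

namespace MissingAnswer

/-- The countably infinite domain of constants: all binary words (the names of the constants). -/
abbrev Dom : Type := List Bool

/-- A finite relational schema. -/
structure Schema where
  Rel : Type
  [finRel : Fintype Rel]
  [decRel : DecidableEq Rel]
  arity : Rel → ℕ

attribute [instance] Schema.finRel Schema.decRel

/-- A fact `R(c₁, …, cₙ)` with `n` the arity of `R`. -/
abbrev Fact (S : Schema) : Type := Σ r : S.Rel, Fin (S.arity r) → Dom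

/-- An instance is a finite set of facts. -/
abbrev Instance (S : Schema) : Type := Finset (Fact S)

/-- Replace each constant of a fact by its image under `ρ`. -/
def Fact.rename {S : Schema} (ρ : Dom → Dom) (f : Fact S) : Fact S := ⟨f.1, ρ ∘ f.2⟩

/-- `ρ(I)`: replace each constant in each fact of `I` by its image under `ρ`. -/
def Instance.rename {S : Schema} (ρ : Dom → Dom) (I : Instance S) : Instance S :=
  Finset.image (Fact.rename ρ) I

/-- An arbitrary class of queries over the schema `S`. Queries are finite expressions, i.e. words
over a finite set of syntax symbols together with the constants. (Variables, for instance, are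
spelled with syntax symbols.) Each query has an arity and maps every instance to a set of tuples of
that arity. The values of `arity` and `ans` outside `queries` are irrelevant. -/
structure QueryClass (S : Schema) where
  /-- the syntax symbols -/
  Symb : Type
  [finSymb : Fintype Symb]
  /-- the queries that belong to the class -/
  queries : Set (List (Symb ⊕ Dom))
  arity : List (Symb ⊕ Dom) → ℕ
  /-- `ans Q I` is the answer `Q(I)` -/
  ans : (Q : List (Symb ⊕ Dom)) → Instance S → Set (Fin (arity Q) → Dom)

/-- The set `adom(Q)` of constants that occur in the query `Q`. -/
def adom {Symb : Type} (Q : List (Symb ⊕ Dom)) : Set Dom := {d | Sum.inr d ∈ Q}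

/-- An update of `I`: finite sets of facts to be inserted and deleted. -/
structure Update {S : Schema} (I : Instance S) where
  ins : Finset (Fact S)
  del : Finset (Fact S)
  ins_new : Disjoint ins I
  del_old : del ⊆ I

namespace Update

variable {S : Schema} {I : Instance S}

/-- The updated instance `I_U = (I ∪ Ins) \ Del`. -/
def apply (U : Update I) : Instance S := (I ∪ U.ins) \ U.del

/-- The size of an update: the number of its insertions and deletions. -/
def size (U : Update I) : ℕ := (U.ins ∪ U.del).card

end Update

/-! ### Encoding of the inputs -/

/-- The finite alphabet in which inputs are written. -/
inductive Letter (Symb Rel : Type) : Type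
  | sym (s : Symb)
  | rel (r : Rel)
  /-- marks the beginning of a constant -/
  | const
  | bit (b : Bool)
  /-- separates the components of an input -/
  | sep

section Encoding

variable {Symb : Type} {S : Schema}

/-- A binary word. -/
def encBits (d : List Bool) : List (Letter Symb S.Rel) := d.map Letter.bit

/-- A constant: a mark followed by its name. -/
def encConst (d : Dom) : List (Letter Symb S.Rel) := Letter.const :: encBits d

/-- A tuple of constants. -/
def encTuple {n : ℕ} (a : Fin n → Dom) : List (Letter Symb S.Rel) :=
  (List.ofFn a).flatMap encConst

/-- A query expression, token by token. -/
def encQuery (Q : List (Symb ⊕ Dom)) : List (Letter Symb S.Rel) :=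
  Q.flatMap (Sum.elim (fun s => [Letter.sym s]) encConst)

/-- A list of facts; a fact is its relation symbol followed by its tuple of constants. -/
def encFacts (F : List (Fact S)) : List (Letter Symb S.Rel) :=
  F.flatMap fun f => Letter.rel f.1 :: encTuple f.2

/-- The word for `⟨Q, I, a⟩`, where `I` is given by a list `F` of its facts. -/
def encEvalInput (Q : List (Symb ⊕ Dom)) (F : List (Fact S)) {n : ℕ} (a : Fin n → Dom) :
    List (Letter Symb S.Rel) :=
  encQuery Q ++ Letter.sep :: (encFacts F ++ Letter.sep :: encTuple a)

/-- The word for `⟨Q, I, a, k⟩`, with `k` in binary (least significant bit first). -/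
def encMAInput (Q : List (Symb ⊕ Dom)) (F : List (Fact S)) {n : ℕ} (a : Fin n → Dom) (k : ℕ) :
    List (Letter Symb S.Rel) :=
  encEvalInput Q F a ++ Letter.sep :: encBits k.bits

end Encoding

/-! ### The decision problems of a class of queries -/

namespace QueryClass

variable {S : Schema} (L : QueryClass S)

/-- `Q` is `D`-generic: `ρ(Q(I)) = Q(ρ(I))` for every instance `I` and every bijection `ρ` of the
domain that fixes `D` pointwise. -/
def IsGenericOver (Q : List (L.Symb ⊕ Dom)) (D : Set Dom) : Prop :=
  ∀ (I : Instance S) (ρ : Equiv.Perm Dom), (∀ d ∈ D, ρ d = d) →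
    (fun t : Fin (L.arity Q) → Dom => ρ ∘ t) '' L.ans Q I = L.ans Q (Instance.rename ρ I)

/-- All queries `Q` of the class are generic, i.e. `adom(Q)`-generic. -/
def IsGeneric : Prop := ∀ Q ∈ L.queries, L.IsGenericOver Q (adom Q)

/-- The evaluation problem: given `⟨Q, I, a⟩` with `Q` in the class, is `a ∈ Q(I)`? -/
def Eval : Language (Letter L.Symb S.Rel) :=
  {w | ∃ Q ∈ L.queries, ∃ (F : List (Fact S)) (a : Fin (L.arity Q) → Dom),
    w = encEvalInput Q F a ∧ a ∈ L.ans Q F.toFinset}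

/-- `U` is a repair with respect to `⟨Q, I, a⟩` if `a ∈ Q(I_U)`. -/
def IsRepair (Q : List (L.Symb ⊕ Dom)) {I : Instance S} (a : Fin (L.arity Q) → Dom)
    (U : Update I) : Prop := a ∈ L.ans Q U.apply

/-- The bounded missing answer problem: given `⟨Q, I, a, k⟩` with `Q` in the class, is there a
repair of size at most `k` with respect to `⟨Q, I, a⟩`? -/
def MABound : Language (Letter L.Symb S.Rel) :=
  {w | ∃ Q ∈ L.queries, ∃ (F : List (Fact S)) (a : Fin (L.arity Q) → Dom) (k : ℕ),
    w = encMAInput Q F a k ∧ ∃ U : Update F.toFinset, L.IsRepair Q a U ∧ U.size ≤ k}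

end QueryClass

end MissingAnswer

/-! ### Nondeterministic stack programs -/

/-! The machine for the bounded problem guesses an update of size at most `k`, writes down the
updated instance, and runs the given machine for evaluation on it. Genericity is what makes the
guess small. Let `n` be the length of the input. A repair of size at most `k < 2 ^ n` inserts at
most `2 ^ n` facts, hence at most `2 ^ n * m` constants, where `m` bounds the arities. All constants
of the query, the instance and the tuple have length at most `n`. There are `2 ^ (n + m + 1)` words
of length `n + m + 1`, so some permutation of the domain fixes every word of length at most `n` and
sends the inserted constants to words of length at most `n + m + 1` (`exists_perm_short`). By
genericity the renamed update is again a repair, and it is no larger (`exists_short_repair`).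

Thus it suffices to guess at most `2 ^ n` edits with facts of polynomial length. The resulting
evaluation input has length at most `2 ^ (c * n + d)` for constants `c` and `d`, and a
nondeterministic exponential-time machine handles it in time doubly exponential in `n`
(`exists_time_bound`). Only completeness needs genericity. For soundness, any sequence of at most
`k` single-fact edits changes the instance in at most `k` facts, so the difference of the two
instances is an update of admissible size.

The machine is obtained by compiling a small language of nondeterministic stack programs. The cost
of a run is measured by the number of entries into loop bodies, which determines the number of
machine steps up to a constant factor depending on the program (`AccWithin.of_run`).
`NTM.exists_prepend` puts such a program in front of a machine. The program `guessUpdate` is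
analysed twice: `reaches_guessUpdate` says that every run yields a legitimate instance, and
`run_guessUpdate` says that every sequence of short edits is realised by a cheap run. Query and
tuple are copied without checking that they are well formed; acceptance by the evaluation machine
certifies that, and unique readability (`List.append_cons_unique`, `encFacts_injective`) recovers
the parts. -/

/-- Nondeterministic programs on stacks that are indexed by `K` and hold letters from `A`. -/
inductive StackProg (K A : Type) : Type
  | push (k : K) (a : A)
  /-- removes the letter `a` from the top of stack `k`; gets stuck if it is not there -/
  | pop (k : K) (a : A)
  /-- gets stuck unless stack `k` is empty -/
  | empty (k : K)
  | fail
  | seq (p q : StackProg K A)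
  | alt (p q : StackProg K A)
  | star (p : StackProg K A)

/-- Instructions of a flow chart with labels from `Λ`. -/
inductive FlowInstr (K A Λ : Type) : Type
  | push (k : K) (a : A) (l : Λ)
  | pop (k : K) (a : A) (l : Λ)
  | empty (k : K) (l : Λ)
  | fail
  | fork (l r : Λ)

namespace StackProg

variable {K A : Type}

/-- `p.Run n s s'`: some run of `p` leads from the stacks `s` to the stacks `s'`, and altogether the
bodies of loops are entered at most `n` times. -/
inductive Run [DecidableEq K] : StackProg K A → ℕ → (K → List A) → (K → List A) → Prop
  | push (k : K) (a : A) (n : ℕ) (s : K → List A) :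
      Run (.push k a) n s (Function.update s k (a :: s k))
  | pop (k : K) (a : A) (n : ℕ) (s : K → List A) (l : List A) (h : s k = a :: l) :
      Run (.pop k a) n s (Function.update s k l)
  | empty (k : K) (n : ℕ) (s : K → List A) (h : s k = []) : Run (.empty k) n s s
  | seq {p q : StackProg K A} {m n : ℕ} {s s' s'' : K → List A} :
      Run p m s s' → Run q n s' s'' → Run (.seq p q) (m + n) s s''
  | altl {p q : StackProg K A} {n : ℕ} {s s' : K → List A} : Run p n s s' → Run (.alt p q) n s s'
  | altr {p q : StackProg K A} {n : ℕ} {s s' : K → List A} : Run q n s s' → Run (.alt p q) n s s'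
  | starNil (p : StackProg K A) (n : ℕ) (s : K → List A) : Run (.star p) n s s
  | starCons {p : StackProg K A} {m n : ℕ} {s s' s'' : K → List A} :
      Run p m s s' → Run (.star p) n s' s'' → Run (.star p) (m + n + 1) s s''

/-- The labels of the flow chart of a program. -/
def Lbl : StackProg K A → Type
  | seq p q => Lbl p ⊕ Lbl q
  | alt p q => Option (Lbl p ⊕ Lbl q)
  | star p => Option (Lbl p)
  | push _ _ => Unit
  | pop _ _ => Unit
  | empty _ => Unit
  | fail => Unit

instance Lbl.finite : (p : StackProg K A) → Finite (Lbl p)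
  | seq p q => by
      have := Lbl.finite p; have := Lbl.finite q
      exact inferInstanceAs (Finite (Lbl p ⊕ Lbl q))
  | alt p q => by
      have := Lbl.finite p; have := Lbl.finite q
      exact inferInstanceAs (Finite (Option (Lbl p ⊕ Lbl q)))
  | star p => by
      have := Lbl.finite p
      exact inferInstanceAs (Finite (Option (Lbl p)))
  | push _ _ => inferInstanceAs (Finite Unit)
  | pop _ _ => inferInstanceAs (Finite Unit)
  | empty _ => inferInstanceAs (Finite Unit)
  | fail => inferInstanceAs (Finite Unit)

/-- The label at which the flow chart is entered. -/
def entry : (p : StackProg K A) → Lbl p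
  | seq p _ => (Sum.inl (entry p) : _ ⊕ _)
  | alt _ _ => (none : Option _)
  | star _ => (none : Option _)
  | push _ _ => ()
  | pop _ _ => ()
  | empty _ => ()
  | fail => ()

/-- The flow chart of a program, where `e` embeds the labels into a type `Λ` and `x` is the label
that is reached at the end. -/
def code {Λ : Type} : (p : StackProg K A) → (e : Lbl p → Λ) → (x : Λ) → Lbl p → FlowInstr K A Λ
  | seq p q, e, x, l =>
    match (l : Lbl p ⊕ Lbl q) with
    | .inl l => code p (fun l => e (Sum.inl l : _ ⊕ _)) (e (Sum.inr (entry q) : _ ⊕ _)) l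
    | .inr l => code q (fun l => e (Sum.inr l : _ ⊕ _)) x l
  | alt p q, e, x, l =>
    match (l : Option (Lbl p ⊕ Lbl q)) with
    | none => .fork (e (some (.inl (entry p)) : Option _)) (e (some (.inr (entry q)) : Option _))
    | some (.inl l) => code p (fun l => e (some (.inl l) : Option _)) x l
    | some (.inr l) => code q (fun l => e (some (.inr l) : Option _)) x l
  | star p, e, x, l =>
    match (l : Option (Lbl p)) with
    | none => .fork x (e (some (entry p) : Option _))
    | some l => code p (fun l => e (some l : Option _)) (e (none : Option _)) l
  | push k a, _, x, _ => .push k a x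
  | pop k a, _, x, _ => .pop k a x
  | empty k, _, x, _ => .empty k x
  | fail, _, _, _ => .fail

/-- The number of constructors of a program. -/
def size : StackProg K A → ℕ
  -- Sequential composition contributes nothing: its flow chart has no label of its own, since the
  -- exit of `p` is the entry of `q`.
  | seq p q => size p + size q
  | alt p q => size p + size q + 1
  | star p => size p + 1
  | push _ _ => 1
  | pop _ _ => 1
  | empty _ => 1
  | fail => 1

end StackProg

/-! ### Acceptance with step counts, and the combined machine -/

namespace NTM

variable {A : Type}

/-- `M` has an accepting computation of exactly `t` steps that starts in `c`. -/
def AccFrom (M : NTM A) (t : ℕ) (c : M.Cfg) : Prop := ∃ c', M.StepsTo t c c' ∧ M.Accepting c'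

theorem accFrom_zero {M : NTM A} {c : M.Cfg} : M.AccFrom 0 c ↔ M.Accepting c := by
  constructor
  · rintro ⟨c', h, h'⟩
    cases h
    exact h'
  · exact fun h => ⟨c, .refl c, h⟩

theorem accFrom_succ {M : NTM A} {t : ℕ} {c : M.Cfg} :
    M.AccFrom (t + 1) c ↔ ∃ c', M.Step c c' ∧ M.AccFrom t c' := by
  constructor
  · rintro ⟨c', h, h'⟩
    cases h with
    | head h₁ h₂ => exact ⟨_, h₁, _, h₂, h'⟩
  · rintro ⟨c', h, c'', h₂, h'⟩
    exact ⟨c'', .head h h₂, h'⟩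

/-- `M` has an accepting computation of at most `t` steps that starts in `c`. -/
def AccWithin (M : NTM A) (t : ℕ) (c : M.Cfg) : Prop := ∃ t' ≤ t, M.AccFrom t' c

theorem AccWithin.mono {M : NTM A} {t t' : ℕ} {c : M.Cfg} (h : M.AccWithin t c) (htt : t ≤ t') :
    M.AccWithin t' c := by
  obtain ⟨u, hu, h⟩ := h
  exact ⟨u, hu.trans htt, h⟩

theorem AccWithin.step {M : NTM A} {t : ℕ} {c c' : M.Cfg} (h : M.AccWithin t c')
    (hs : M.Step c c') : M.AccWithin (t + 1) c := by
  obtain ⟨u, hu, h⟩ := h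
  exact ⟨u + 1, by omega, accFrom_succ.2 ⟨c', hs, h⟩⟩

/-! ### Running a machine on the output of a stack program -/

section Prepend

open Turing.TM2

variable (M : NTM A) {K : Type} (p : StackProg K A)

/-- The stacks of the combined machine. -/
abbrev PreΓ (K : Type) : M.K ⊕ K → Type
  | .inl k => M.Γ k
  | .inr _ => A

/-- The labels of the combined machine; `Sum.inr none` is the loop that copies the output of the
program to the input stack of `M`. -/
abbrev PreΛ : Type := p.Lbl ⊕ Option M.Λ

/-- The internal states of the combined machine. -/
abbrev Preσ : Type := Option A × M.σ

/-- The statements of `M` as statements of the combined machine. -/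
def liftStmt : Stmt M.Γ M.Λ M.σ → Stmt (M.PreΓ K) (M.PreΛ p) M.Preσ
  | .push k f q => .push (Sum.inl k) (fun s => f s.2) (liftStmt q)
  | .peek k f q => .peek (Sum.inl k) (fun s o => (s.1, f s.2 o)) (liftStmt q)
  | .pop k f q => .pop (Sum.inl k) (fun s o => (s.1, f s.2 o)) (liftStmt q)
  | .load f q => .load (fun s => (s.1, f s.2)) (liftStmt q)
  | .branch f q r => .branch (fun s => f s.2) (liftStmt q) (liftStmt r)
  | .goto f => .goto fun s => .inr (some (f s.2))
  | .halt => .halt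

open Classical in
/-- The statement for an instruction of the flow chart. -/
noncomputable def instrStmt [Inhabited A] (b : Bool) :
    FlowInstr K A (M.PreΛ p) → Stmt (M.PreΓ K) (M.PreΛ p) M.Preσ
  | .push k a l => .push (Sum.inr k) (fun _ => a) (.goto fun _ => l)
  -- Halting with a letter in the register means rejection. After a failed pop the register is empty
  -- if the stack was, hence the explicit load; after a failed emptiness test it already holds the
  -- top letter.
  | .pop k a l => .pop (Sum.inr k) (fun s o => (o, s.2))
      (.branch (fun s => decide (s.1 = some a)) (.goto fun _ => l)
        (.load (fun s => (some a, s.2)) .halt))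
  | .empty k l => .peek (Sum.inr k) (fun s o => (o, s.2))
      (.branch (fun s => s.1.isNone) (.goto fun _ => l) .halt)
  | .fail => .load (fun s => (some default, s.2)) .halt
  | .fork l r => .goto fun _ => bif b then r else l

/-- The statement that moves a letter from the output stack of the program to the input stack
of `M`. -/
def copyStmt [Inhabited A] (out : K) : Stmt (M.PreΓ K) (M.PreΛ p) M.Preσ :=
  .pop (Sum.inr out) (fun s o => (o, s.2))
    (.branch (fun s => s.1.isSome)
      -- The default is never used, because this branch is taken only when a letter was popped.
      (.push (Sum.inl M.inStack) (fun s => M.inLetter (s.1.getD default))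
        (.goto fun _ => .inr none))
      (.goto fun _ => .inr (some M.start)))

instance (M : NTM A) : DecidableEq M.K := M.decK
instance (M : NTM A) : Fintype M.K := M.finK
instance (M : NTM A) : Fintype M.Λ := M.finΛ
instance (M : NTM A) : Fintype M.σ := M.finσ
instance (M : NTM A) (k : M.K) : Fintype (M.Γ k) := M.finΓ k

/-- The machine that runs the program `p`, with input stack `inp`, and then `M` on the content of
the stack `out` (from bottom to top). -/
@[reducible] noncomputable def prepend [Inhabited A] [Fintype A] [DecidableEq K] [Fintype K]
    (inp out : K) :
    NTM A where
  K := M.K ⊕ K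
  Γ := M.PreΓ K
  finΓ := fun k => by cases k <;> infer_instance
  Λ := M.PreΛ p
  finΛ := Fintype.ofFinite _
  σ := M.Preσ
  inStack := .inr inp
  inLetter := Function.Embedding.refl A
  start := .inl p.entry
  init := (none, M.init)
  -- The empty register separates halting of `M` from a program that got stuck. Copying ends with a
  -- pop from an empty stack, which clears the register, and the lifted statements never change it.
  accept := {s | s.1 = none ∧ s.2 ∈ M.accept}
  prog b
    | .inl l => M.instrStmt p b (p.code .inl (.inr none) l)
    | .inr none => M.copyStmt p out
    | .inr (some l) => M.liftStmt p (M.prog b l)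

variable {M p}

/-- The stacks of the combined machine, put together from those of `M` and those of the program. -/
def joinStk (S₁ : ∀ k, List (M.Γ k)) (S : K → List A) : ∀ k, List (M.PreΓ K k)
  | .inl k => S₁ k
  | .inr k => S k

theorem update_joinStk_inl [DecidableEq K] (S₁ : ∀ k, List (M.Γ k)) (S : K → List A) (k : M.K)
    (l : List (M.Γ k)) :
    Function.update (joinStk S₁ S) (.inl k) l = joinStk (Function.update S₁ k l) S := by
  refine Function.update_eq_iff.2 ⟨(Function.update_self k l S₁).symm, fun j hj => ?_⟩
  rcases j with j | j
  · exact (Function.update_of_ne (fun h => hj (congrArg Sum.inl h)) l S₁).symm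
  · rfl

theorem update_joinStk_inr [DecidableEq K] (S₁ : ∀ k, List (M.Γ k)) (S : K → List A) (k : K)
    (l : List A) :
    Function.update (joinStk S₁ S) (.inr k) l = joinStk S₁ (Function.update S k l) := by
  refine Function.update_eq_iff.2 ⟨(Function.update_self k l S).symm, fun j hj => ?_⟩
  rcases j with j | j
  · rfl
  · exact (Function.update_of_ne (fun h => hj (congrArg Sum.inr h)) l S).symm

theorem step_iff {M : NTM A} {l : M.Λ} {v : M.σ} {S : ∀ k, List (M.Γ k)} {c : M.Cfg} :
    M.Step ⟨some l, v, S⟩ c ↔ ∃ b, stepAux (M.prog b l) v S = c := by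
  simp only [Step]
  exact exists_congr fun b => Option.some_inj

theorem not_step_halted {M : NTM A} {v : M.σ} {S : ∀ k, List (M.Γ k)} {c : M.Cfg} :
    ¬ M.Step ⟨none, v, S⟩ c := by
  rintro ⟨b, h⟩
  exact absurd h (by simp [Turing.TM2.step])

variable [Inhabited A] [Fintype A] [DecidableEq K] [Fintype K] {inp out : K}

/-- A configuration of `M` as a configuration of the combined machine. -/
def liftCfg (S : K → List A) (c : M.Cfg) : (M.prepend p inp out).Cfg :=
  ⟨c.l.map fun l => .inr (some l), (none, c.var), joinStk c.stk S⟩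

theorem stepAux_liftStmt (q : Stmt M.Γ M.Λ M.σ) (v : M.σ) (S₁ : ∀ k, List (M.Γ k))
    (S : K → List A) :
    stepAux (M.liftStmt p q) (none, v) (joinStk S₁ S) =
      liftCfg (p := p) (inp := inp) (out := out) S (stepAux q v S₁) := by
  induction q generalizing v S₁ with
  | push k f q ih =>
    simp only [liftStmt, stepAux]
    exact (congrArg _ (update_joinStk_inl _ _ _ _)).trans (ih _ _)
  | peek k f q ih =>
    simp only [liftStmt, stepAux]
    exact ih _ _
  | pop k f q ih =>
    simp only [liftStmt, stepAux]
    exact (congrArg _ (update_joinStk_inl _ _ _ _)).trans (ih _ _)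
  | load f q ih =>
    simp only [liftStmt, stepAux]
    exact ih _ _
  | branch f q r ih₁ ih₂ =>
    simp only [liftStmt, stepAux]
    cases f v
    · exact ih₂ _ _
    · exact ih₁ _ _
  | goto f => rfl
  | halt => rfl

/-- Once the register is empty and `M` has control, the steps of both machines correspond one to
one, and the stacks of the program are inert. -/
theorem accFrom_liftCfg {S : K → List A} {t : ℕ} {c : M.Cfg} :
    (M.prepend p inp out).AccFrom t (liftCfg S c) ↔ M.AccFrom t c := by
  induction t generalizing c with
  | zero =>
    simp only [accFrom_zero, Accepting, liftCfg, prepend, Option.map_eq_none_iff]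
    simp
  | succ t ih =>
    obtain ⟨l, v, S₁⟩ := c
    simp only [accFrom_succ]
    cases l with
    | none =>
      constructor
      · rintro ⟨c', h, -⟩
        exact absurd h not_step_halted
      · rintro ⟨c', h, -⟩
        exact absurd h not_step_halted
    | some l =>
      constructor
      · rintro ⟨c', h, h'⟩
        obtain ⟨b, rfl⟩ := step_iff.1 h
        refine ⟨_, step_iff.2 ⟨b, rfl⟩, ih.1 ?_⟩
        rw [← stepAux_liftStmt]
        exact h'
      · rintro ⟨c', h, h'⟩
        obtain ⟨b, rfl⟩ := step_iff.1 h
        exact ⟨_, step_iff.2 ⟨b, stepAux_liftStmt (p := p) _ _ _ S⟩, ih.2 h'⟩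

/-- A configuration of the combined machine while the program is running or its output is being
copied. -/
def progCfg (l : M.PreΛ p) (r : Option A) (u : List (M.Γ M.inStack)) (S : K → List A) :
    (M.prepend p inp out).Cfg :=
  ⟨some l, (r, M.init), joinStk (Function.update (fun _ => []) M.inStack u) S⟩

theorem step_copy {r : Option A} {u : List (M.Γ M.inStack)} {S : K → List A}
    {c : (M.prepend p inp out).Cfg} : (M.prepend p inp out).Step (progCfg (.inr none) r u S) c ↔
      c = match S out with
        | [] => ⟨some (.inr (some M.start)), (none, M.init),
            joinStk (Function.update (fun _ => []) M.inStack u) S⟩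
        | a :: l => progCfg (.inr none) (some a) (M.inLetter a :: u) (Function.update S out l) := by
  rw [progCfg, step_iff]
  change (∃ b : Bool, stepAux (M.copyStmt p out) _ _ = c) ↔ _
  simp only [exists_const]
  rw [eq_comm]
  apply Eq.congr_right
  have hout : joinStk (Function.update (fun _ => []) M.inStack u) S (.inr out) = S out := rfl
  rw [copyStmt, stepAux, hout, update_joinStk_inr]
  cases h : S out with
  | nil =>
    have : Function.update S out [] = S := by rw [← h]; exact Function.update_eq_self _ _
    simp [stepAux, this]
  | cons a l =>
    simp [stepAux, update_joinStk_inl, progCfg, joinStk]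

/-- Copying is deterministic: one step per letter and one more to notice that the stack is empty.
Moving letter by letter reverses the word, so `M` reads the output from bottom to top. -/
theorem accFrom_copy {t : ℕ} {r : Option A} {u : List (M.Γ M.inStack)} {S : K → List A} :
    (M.prepend p inp out).AccFrom (t + (S out).length + 1) (progCfg (.inr none) r u S) ↔
      M.AccFrom t ⟨some M.start, M.init, Function.update (fun _ => []) M.inStack
        ((S out).reverse.map M.inLetter ++ u)⟩ := by
  generalize h : S out = v
  induction v generalizing r u S with
  | nil =>
    rw [accFrom_succ]
    simp only [step_copy, h, exists_eq_left, List.length_nil]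
    exact accFrom_liftCfg (c := ⟨some M.start, M.init, Function.update (fun _ => []) M.inStack u⟩)
  | cons a l ih =>
    rw [accFrom_succ]
    simp only [step_copy, h, exists_eq_left, List.length_cons]
    rw [← add_assoc, ih (by simp)]
    simp

/-- An accepting computation cannot end while copying is in progress; this allows the exact count in
`accFrom_copy` to be applied to an arbitrary accepting computation. -/
theorem accFrom_copy_le {t : ℕ} {r : Option A} {u : List (M.Γ M.inStack)} {S : K → List A}
    (h : (M.prepend p inp out).AccFrom t (progCfg (.inr none) r u S)) :
    (S out).length + 1 ≤ t := by
  generalize hv : S out = v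
  induction v generalizing t r u S with
  | nil =>
    cases t with
    | zero => simp [accFrom_zero, Accepting, progCfg] at h
    | succ t => simp
  | cons a l ih =>
    cases t with
    | zero => simp [accFrom_zero, Accepting, progCfg] at h
    | succ t =>
      rw [accFrom_succ] at h
      simp only [step_copy, hv, exists_eq_left] at h
      simpa using ih h (by simp)

end Prepend

end NTM

/-! ### Correctness and running time of the combined machine -/

namespace NTM

variable {A : Type}

section Prepend

open Turing.TM2

variable {M : NTM A} {K : Type} {p : StackProg K A}
variable [Inhabited A] [Fintype A] [DecidableEq K] [Fintype K] {inp out : K}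

-- The two transition functions differ only at a fork, so every other instruction has a single
-- successor.
open Classical in
theorem step_progCfg {l : M.PreΛ p} {i : FlowInstr K A (M.PreΛ p)} {r : Option A}
    {S : K → List A} {c : (M.prepend p inp out).Cfg}
    (hi : ∀ b, (M.prepend p inp out).prog b l = M.instrStmt p b i) :
    (M.prepend p inp out).Step (progCfg l r [] S) c ↔
      match i with
      | .push k a x => c = progCfg x r [] (Function.update S k (a :: S k))
      | .pop k a x => c = if (S k).head? = some a
          then progCfg x (some a) [] (Function.update S k (S k).tail)
          else ⟨none, (some a, M.init), joinStk (Function.update (fun _ => []) M.inStack [])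
            (Function.update S k (S k).tail)⟩
      | .empty k x => c = if S k = [] then progCfg x none [] S
          else ⟨none, ((S k).head?, M.init),
            joinStk (Function.update (fun _ => []) M.inStack []) S⟩
      | .fail => c = ⟨none, (some default, M.init),
            joinStk (Function.update (fun _ => []) M.inStack []) S⟩
      | .fork x y => c = progCfg x r [] S ∨ c = progCfg y r [] S := by
  rw [progCfg, step_iff]
  refine (exists_congr fun b => iff_of_eq (congrArg (fun q => stepAux q _ _ = c) (hi b))).trans ?_
  have hk : ∀ k, joinStk (Function.update (fun _ => []) M.inStack []) S (.inr k) = S k :=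
    fun _ => rfl
  cases i with
  | push k a x =>
    simp only [exists_const, instrStmt, stepAux, hk, update_joinStk_inr]
    exact eq_comm
  | pop k a x =>
    simp only [exists_const, instrStmt, stepAux, hk, update_joinStk_inr]
    rw [eq_comm]
    apply Eq.congr_right
    by_cases h : (S k).head? = some a
    · simp [h, progCfg]
    · simp [h]
  | empty k x =>
    simp only [exists_const, instrStmt, stepAux, hk]
    rw [eq_comm]
    apply Eq.congr_right
    cases h : S k
    · simp [progCfg]
    · simp
  | fail =>
    simp only [exists_const, instrStmt, stepAux]
    exact eq_comm
  | fork x y =>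
    simp only [instrStmt, stepAux, Bool.exists_bool, cond_false, cond_true]
    exact or_congr eq_comm eq_comm

theorem not_accFrom_rejecting {t : ℕ} {a : A} {v : M.σ}
    {S : ∀ k, List (M.PreΓ K k)} :
    ¬ (M.prepend p inp out).AccFrom t ⟨none, (some a, v), S⟩ := by
  cases t with
  | zero => simp [accFrom_zero, Accepting]
  | succ t =>
    rw [accFrom_succ]
    rintro ⟨c', h, -⟩
    exact not_step_halted h

/-- An accepting computation that enters the flow chart of `q` leaves it again, after a run
of `q`. -/
theorem AccFrom.exists_run {q : StackProg K A} {e : q.Lbl → M.PreΛ p} {x : M.PreΛ p}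
    (H : ∀ b l, (M.prepend p inp out).prog b (e l) = M.instrStmt p b (q.code e x l)) {t : ℕ}
    {r : Option A} {S : K → List A}
    (h : (M.prepend p inp out).AccFrom t (progCfg (e q.entry) r [] S)) :
    ∃ n S' r' t', q.Run n S S' ∧ t' < t ∧
      (M.prepend p inp out).AccFrom t' (progCfg x r' [] S') := by
  induction q generalizing x t r S with
  | push k a =>
    cases t with
    | zero => simp [accFrom_zero, Accepting, progCfg] at h
    | succ t =>
      obtain ⟨c, hc, h⟩ := accFrom_succ.1 h
      rw [step_progCfg (fun b => H b _)] at hc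
      simp only [StackProg.code] at hc
      subst hc
      exact ⟨0, _, _, t, .push _ _ _ _, by omega, h⟩
  | pop k a =>
    cases t with
    | zero => simp [accFrom_zero, Accepting, progCfg] at h
    | succ t =>
      obtain ⟨c, hc, h⟩ := accFrom_succ.1 h
      rw [step_progCfg (fun b => H b _)] at hc
      simp only [StackProg.code] at hc
      split_ifs at hc with ha
      · subst hc
        exact ⟨0, _, _, t, .pop _ _ _ _ _ (List.eq_cons_of_mem_head? ha), by omega, h⟩
      · subst hc
        exact absurd h not_accFrom_rejecting
  | empty k =>
    cases t with
    | zero => simp [accFrom_zero, Accepting, progCfg] at h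
    | succ t =>
      obtain ⟨c, hc, h⟩ := accFrom_succ.1 h
      rw [step_progCfg (fun b => H b _)] at hc
      simp only [StackProg.code] at hc
      split_ifs at hc with ha
      · subst hc
        exact ⟨0, _, _, t, .empty _ _ _ ha, by omega, h⟩
      · obtain ⟨a, l, hal⟩ := List.exists_cons_of_ne_nil ha
        rw [hal] at hc
        subst hc
        exact absurd h not_accFrom_rejecting
  | fail =>
    cases t with
    | zero => simp [accFrom_zero, Accepting, progCfg] at h
    | succ t =>
      obtain ⟨c, hc, h⟩ := accFrom_succ.1 h
      rw [step_progCfg (fun b => H b _)] at hc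
      simp only [StackProg.code] at hc
      subst hc
      exact absurd h not_accFrom_rejecting
  | seq q₁ q₂ ih₁ ih₂ =>
    obtain ⟨m, S₁, r₁, t₁, h₁, ht₁, ha₁⟩ := ih₁ (fun b l => H b (Sum.inl l : _ ⊕ _)) h
    obtain ⟨n, S₂, r₂, t₂, h₂, ht₂, ha₂⟩ := ih₂ (fun b l => H b (Sum.inr l : _ ⊕ _)) ha₁
    exact ⟨_, _, _, _, h₁.seq h₂, ht₂.trans ht₁, ha₂⟩
  | alt q₁ q₂ ih₁ ih₂ =>
    cases t with
    | zero => simp [accFrom_zero, Accepting, progCfg] at h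
    | succ t =>
      obtain ⟨c, hc, h⟩ := accFrom_succ.1 h
      rw [step_progCfg (fun b => H b _)] at hc
      simp only [StackProg.code, StackProg.entry] at hc
      rcases hc with rfl | rfl
      · obtain ⟨m, S₁, r₁, t₁, h₁, ht₁, ha₁⟩ := ih₁ (fun b l => H b (some (.inl l) : Option _)) h
        exact ⟨_, _, _, _, h₁.altl, by omega, ha₁⟩
      · obtain ⟨m, S₁, r₁, t₁, h₁, ht₁, ha₁⟩ := ih₂ (fun b l => H b (some (.inr l) : Option _)) h
        exact ⟨_, _, _, _, h₁.altr, by omega, ha₁⟩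
  | star q ih =>
    -- The body leads back to the loop head, so structural induction alone does not suffice; the
    -- number of remaining steps has strictly decreased by then.
    induction t using Nat.strong_induction_on generalizing r S with
    | _ t iht =>
      cases t with
      | zero => simp [accFrom_zero, Accepting, progCfg] at h
      | succ t =>
        obtain ⟨c, hc, h⟩ := accFrom_succ.1 h
        rw [step_progCfg (fun b => H b _)] at hc
        simp only [StackProg.code, StackProg.entry] at hc
        rcases hc with rfl | rfl
        · exact ⟨0, _, _, t, .starNil _ _ _, by omega, h⟩
        · obtain ⟨m, S₁, r₁, t₁, h₁, ht₁, ha₁⟩ := ih (fun b l => H b (some l : Option _)) h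
          obtain ⟨n, S₂, r₂, t₂, h₂, ht₂, ha₂⟩ := iht t₁ (by omega) ha₁
          exact ⟨_, _, _, _, h₁.starCons h₂, by omega, ha₂⟩

/-- Without entering a loop body, control only moves forward through the flow chart, so at most
`q.size` steps pass between two entries; this gives the factor `n + 1`. The continuation must accept
from every register, because the register after the run depends on the last pop or test. -/
theorem AccWithin.of_run {q : StackProg K A} {e : q.Lbl → M.PreΛ p} {x : M.PreΛ p}
    (H : ∀ b l, (M.prepend p inp out).prog b (e l) = M.instrStmt p b (q.code e x l))
    {n t : ℕ} {S S' : K → List A} (hr : q.Run n S S')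
    (h : ∀ r, (M.prepend p inp out).AccWithin t (progCfg x r [] S')) (r : Option A) :
    (M.prepend p inp out).AccWithin (t + q.size * (n + 1)) (progCfg (e q.entry) r [] S) := by
  induction hr generalizing x t r with
  | push k a n s =>
    refine ((h r).step ?_).mono (Nat.add_le_add_left (Nat.mul_pos one_pos n.succ_pos) t)
    rw [step_progCfg (fun b => H b _)]
    rfl
  | pop k a n s l hl =>
    refine ((h (some a)).step ?_).mono (Nat.add_le_add_left (Nat.mul_pos one_pos n.succ_pos) t)
    rw [step_progCfg (fun b => H b _)]
    simp [StackProg.code, hl]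
  | empty k n s hl =>
    refine ((h none).step ?_).mono (Nat.add_le_add_left (Nat.mul_pos one_pos n.succ_pos) t)
    rw [step_progCfg (fun b => H b _)]
    simp [StackProg.code, hl]
  | @seq q₁ q₂ m n s s' s'' h₁ h₂ ih₁ ih₂ =>
    refine (ih₁ (fun b l => H b (Sum.inl l : _ ⊕ _))
      (fun r => ih₂ (fun b l => H b (Sum.inr l : _ ⊕ _)) h r) r).mono ?_
    simp only [StackProg.size]
    nlinarith
  | @altl q₁ q₂ n s s' h₁ ih =>
    refine ((ih (fun b l => H b (some (.inl l) : Option _)) h r).step ?_).mono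
      (t' := t + (q₁.size + q₂.size + 1) * (n + 1)) ?_
    · rw [step_progCfg (fun b => H b _)]
      exact .inl rfl
    · nlinarith
  | @altr q₁ q₂ n s s' h₁ ih =>
    refine ((ih (fun b l => H b (some (.inr l) : Option _)) h r).step ?_).mono
      (t' := t + (q₁.size + q₂.size + 1) * (n + 1)) ?_
    · rw [step_progCfg (fun b => H b _)]
      exact .inr rfl
    · nlinarith
  | starNil q n s =>
    refine ((h r).step ?_).mono (Nat.add_le_add_left (Nat.mul_pos q.size.succ_pos n.succ_pos) t)
    rw [step_progCfg (fun b => H b _)]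
    exact .inl rfl
  | @starCons q m n s s' s'' h₁ h₂ ih₁ ih₂ =>
    refine ((ih₁ (fun b l => H b (some l : Option _)) (fun r => ih₂ H h r) r).step ?_).mono
      (t' := t + (q.size + 1) * (m + n + 1 + 1)) ?_
    · rw [step_progCfg (fun b => H b _)]
      exact .inr rfl
    · simp only [StackProg.size]
      nlinarith

theorem initial_prepend (w : List A) : (M.prepend p inp out).initial w =
    progCfg (.inl p.entry) none [] (Function.update (fun _ => []) inp w) := by
  simp only [initial, progCfg]
  have h : (fun _ => [] : ∀ k, List (M.PreΓ K k)) =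
      joinStk (Function.update (fun _ => []) M.inStack []) fun _ => [] := by
    funext k
    rcases k with k | k
    · by_cases hk : k = M.inStack
      · subst hk; simp [joinStk]
      · simp [joinStk, hk]
    · rfl
  congr 1
  rw [← update_joinStk_inr, ← h]
  exact congrArg _ (List.map_id w)

end Prepend

/-- The nondeterministic preprocessing of the input by a stack program. -/
theorem exists_prepend [Finite A] [Inhabited A] {K : Type} [DecidableEq K] [Fintype K]
    (M : NTM A) (p : StackProg K A) (inp out : K) :
    ∃ N : NTM A,
      (∀ w t, N.AcceptsIn w t → ∃ n S t', p.Run n (Function.update (fun _ => []) inp w) S ∧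
        M.AcceptsIn (S out).reverse t') ∧
      (∀ w n S t, p.Run n (Function.update (fun _ => []) inp w) S →
        M.AcceptsIn (S out).reverse t →
        ∃ t' ≤ t + (S out).length + 1 + p.size * (n + 1), N.AcceptsIn w t') := by
  have := Fintype.ofFinite A
  have H : ∀ b l, (M.prepend p inp out).prog b (.inl l) =
    M.instrStmt p b (p.code .inl (.inr none) l) := fun _ _ => rfl
  refine ⟨M.prepend p inp out, fun w t h => ?_, fun w n S t hr h => ?_⟩
  · have h' : (M.prepend p inp out).AccFrom t ((M.prepend p inp out).initial w) := h
    rw [initial_prepend] at h'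
    obtain ⟨n, S, r, t', hr, -, ha⟩ := AccFrom.exists_run H h'
    obtain ⟨u, rfl⟩ := Nat.exists_eq_add_of_le' (accFrom_copy_le ha)
    rw [← add_assoc, accFrom_copy, List.append_nil] at ha
    exact ⟨n, S, u, hr, ha⟩
  · have h' : M.AccFrom t (M.initial (S out).reverse) := h
    have := AccWithin.of_run (M := M) (p := p) (inp := inp) (out := out) (r := none) H hr
      (t := t + (S out).length + 1)
      fun r => ⟨_, le_rfl, accFrom_copy.2 (by rw [List.append_nil]; exact h')⟩
    rw [← initial_prepend] at this
    exact this

end NTM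

/-! ### Input-output behaviour of stack programs: `Reaches` for soundness, `Run` with cost for
completeness -/

namespace StackProg

variable {K A : Type} [DecidableEq K]

theorem Run.mono {p : StackProg K A} {m n : ℕ} {s s' : K → List A} (h : p.Run m s s')
    (hmn : m ≤ n) : p.Run n s s' := by
  induction h generalizing n with
  | push k a m s => exact .push k a n s
  | pop k a m s l h => exact .pop k a n s l h
  | empty k m s h => exact .empty k n s h
  | @seq p q m₁ m₂ s s' s'' h₁ h₂ ih₁ ih₂ =>
    obtain ⟨d, rfl⟩ := Nat.exists_eq_add_of_le hmn
    rw [add_assoc]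
    exact .seq h₁ (ih₂ (by omega))
  | altl h ih => exact .altl (ih hmn)
  | altr h ih => exact .altr (ih hmn)
  | starNil p m s => exact .starNil p n s
  | @starCons p m₁ m₂ s s' s'' h₁ h₂ ih₁ ih₂ =>
    obtain ⟨d, rfl⟩ := Nat.exists_eq_add_of_le hmn
    rw [show m₁ + m₂ + 1 + d = m₁ + (m₂ + d) + 1 by omega]
    exact .starCons h₁ (ih₂ (by omega))

/-- Some run of `p` leads from `s` to `s'`. -/
def Reaches (p : StackProg K A) (s s' : K → List A) : Prop := ∃ n, p.Run n s s'

theorem Run.reaches {p : StackProg K A} {n : ℕ} {s s' : K → List A} (h : p.Run n s s') :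
    p.Reaches s s' := ⟨n, h⟩

theorem reaches_push {k : K} {a : A} {s s' : K → List A} :
    (push k a).Reaches s s' ↔ s' = Function.update s k (a :: s k) := by
  constructor
  · rintro ⟨n, h⟩
    cases h
    rfl
  · rintro rfl
    exact ⟨0, .push k a 0 s⟩

theorem reaches_pop {k : K} {a : A} {s s' : K → List A} :
    (pop k a).Reaches s s' ↔ ∃ l, s k = a :: l ∧ s' = Function.update s k l := by
  constructor
  · rintro ⟨n, h⟩
    cases h with
    | pop _ _ _ _ l h => exact ⟨l, h, rfl⟩
  · rintro ⟨l, h, rfl⟩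
    exact ⟨0, .pop k a 0 s l h⟩

theorem reaches_empty {k : K} {s s' : K → List A} :
    (empty k).Reaches s s' ↔ s k = [] ∧ s' = s := by
  constructor
  · rintro ⟨n, h⟩
    cases h with
    | empty _ _ _ h => exact ⟨h, rfl⟩
  · rintro ⟨h, rfl⟩
    exact ⟨0, .empty k 0 s' h⟩

theorem not_reaches_fail {s s' : K → List A} : ¬ (fail : StackProg K A).Reaches s s' := by
  rintro ⟨n, h⟩
  cases h

theorem reaches_seq {p q : StackProg K A} {s s' : K → List A} :
    (seq p q).Reaches s s' ↔ ∃ s₁, p.Reaches s s₁ ∧ q.Reaches s₁ s' := by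
  constructor
  · rintro ⟨n, h⟩
    cases h with
    | seq h₁ h₂ => exact ⟨_, ⟨_, h₁⟩, ⟨_, h₂⟩⟩
  · rintro ⟨s₁, ⟨m, h₁⟩, ⟨n, h₂⟩⟩
    exact ⟨_, h₁.seq h₂⟩

theorem reaches_alt {p q : StackProg K A} {s s' : K → List A} :
    (alt p q).Reaches s s' ↔ p.Reaches s s' ∨ q.Reaches s s' := by
  constructor
  · rintro ⟨n, h⟩
    cases h with
    | altl h => exact .inl ⟨_, h⟩
    | altr h => exact .inr ⟨_, h⟩
  · rintro (⟨n, h⟩ | ⟨n, h⟩)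
    · exact ⟨_, h.altl⟩
    · exact ⟨_, h.altr⟩

/-- Induction on the iterations of a loop, from the end. -/
theorem Reaches.star_induction {p : StackProg K A} {motive : (K → List A) → Prop}
    {s s' : K → List A} (h : (star p).Reaches s s') (nil : motive s')
    (cons : ∀ s₁ s₂, p.Reaches s₁ s₂ → motive s₂ → motive s₁) : motive s := by
  obtain ⟨n, h⟩ := h
  generalize hq : star p = q at h
  induction h with
  | starNil => exact nil
  | starCons h₁ h₂ ih₁ ih₂ =>
    cases hq
    exact cons _ _ h₁.reaches (ih₂ nil rfl)
  | _ => cases hq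

/-- Induction on the iterations of a loop, from the beginning. -/
theorem Reaches.star_invariant {p : StackProg K A} {motive : (K → List A) → Prop}
    {s s' : K → List A} (h : (star p).Reaches s s') (init : motive s)
    (step : ∀ s₁ s₂, motive s₁ → p.Reaches s₁ s₂ → motive s₂) : motive s' :=
  h.star_induction (motive := fun s => motive s → motive s') id
    (fun s₁ s₂ h₁ h₂ h => h₂ (step s₁ s₂ h h₁)) init

/-- Nondeterministic choice from a list of programs. -/
def choice : List (StackProg K A) → StackProg K A
  | [] => fail
  | p :: l => alt p (choice l)

theorem Run.choice {l : List (StackProg K A)} {p : StackProg K A} (hp : p ∈ l) {n : ℕ}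
    {s s' : K → List A} (h : p.Run n s s') : (choice l).Run n s s' := by
  induction l with
  | nil => simp at hp
  | cons q l ih =>
    rcases List.mem_cons.1 hp with rfl | hp
    · exact .altl h
    · exact .altr (ih hp)

theorem Reaches.of_choice {l : List (StackProg K A)} {s s' : K → List A}
    (h : (choice l).Reaches s s') : ∃ p ∈ l, p.Reaches s s' := by
  induction l with
  | nil => exact absurd h not_reaches_fail
  | cons q l ih =>
    rcases reaches_alt.1 h with h | h
    · exact ⟨q, by simp, h⟩
    · obtain ⟨p, hp, h⟩ := ih h
      exact ⟨p, by simp [hp], h⟩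

/-- Nondeterministic choice from a finite family of programs. -/
noncomputable def anyOf {ι : Type} [Finite ι] (f : ι → StackProg K A) : StackProg K A :=
  choice ((@Finset.univ ι (Fintype.ofFinite ι)).toList.map f)

theorem Run.anyOf {ι : Type} [Finite ι] {f : ι → StackProg K A} (i : ι) {n : ℕ}
    {s s' : K → List A} (h : (f i).Run n s s') : (anyOf f).Run n s s' :=
  h.choice (List.mem_map_of_mem (by simp))

theorem reaches_anyOf {ι : Type} [Finite ι] {f : ι → StackProg K A} {s s' : K → List A} :
    (anyOf f).Reaches s s' ↔ ∃ i, (f i).Reaches s s' := by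
  constructor
  · intro h
    obtain ⟨p, hp, h⟩ := h.of_choice
    obtain ⟨i, -, rfl⟩ := List.mem_map.1 hp
    exact ⟨i, h⟩
  · rintro ⟨i, n, h⟩
    exact ⟨n, h.anyOf i⟩

/-- The program that does nothing. -/
def skip : StackProg K A := star fail

theorem run_skip (n : ℕ) (s : K → List A) : skip.Run n s s := .starNil _ _ _

theorem reaches_skip {s s' : K → List A} : skip.Reaches s s' ↔ s' = s := by
  constructor
  · intro h
    exact h.star_invariant (motive := fun t => t = s) rfl fun _ _ _ h => absurd h not_reaches_fail
  · rintro rfl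
    exact ⟨0, run_skip 0 _⟩

/-- `p` repeated `n` times. -/
def rep : ℕ → StackProg K A → StackProg K A
  | 0, _ => skip
  | n + 1, p => seq p (rep n p)

/-- From `s` to `s'` the word `u` moves from the top of stack `k` to the top of stack `l`, letter by
letter. -/
def Xfer (k l : K) (u : List A) (s s' : K → List A) : Prop :=
  ∃ r, s k = u ++ r ∧ s' = Function.update (Function.update s k r) l (u.reverse ++ s l)

theorem Xfer.nil (k l : K) (s : K → List A) : Xfer k l [] s s := ⟨s k, rfl, by simp⟩

theorem Xfer.append {k l : K} (hkl : k ≠ l) {u v : List A} {s s₁ s₂ : K → List A}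
    (h₁ : Xfer k l u s s₁) (h₂ : Xfer k l v s₁ s₂) : Xfer k l (u ++ v) s s₂ := by
  obtain ⟨r, hr, rfl⟩ := h₁
  obtain ⟨r', hr', rfl⟩ := h₂
  rw [Function.update_of_ne hkl, Function.update_self] at hr'
  refine ⟨r', by simp [hr, hr'], ?_⟩
  funext j
  by_cases hj : j = l
  · subst hj
    simp
  · by_cases hk : j = k
    · subst hk
      simp [hj]
    · simp [hj, hk]

/-- Converse of `Xfer.append`: a prescribed transfer can be cut into pieces, from which runs are
assembled. -/
theorem Xfer.exists_of_append {k l : K} (hkl : k ≠ l) {u v : List A} {s s₂ : K → List A}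
    (h : Xfer k l (u ++ v) s s₂) : ∃ s₁, Xfer k l u s s₁ ∧ Xfer k l v s₁ s₂ := by
  obtain ⟨r, hr, rfl⟩ := h
  refine ⟨_, ⟨v ++ r, by simp [hr], rfl⟩, r, ?_, ?_⟩
  · rw [Function.update_of_ne hkl, Function.update_self]
  · funext j
    by_cases hj : j = l
    · subst hj
      simp
    · by_cases hk : j = k
      · subst hk
        simp [hj]
      · simp [hj, hk]

/-- Move the letter `a` from stack `k` to stack `l`. -/
def move1 (k l : K) (a : A) : StackProg K A := seq (pop k a) (push l a)

theorem reaches_move1 {k l : K} (hkl : k ≠ l) {a : A} {s s' : K → List A} :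
    (move1 k l a).Reaches s s' ↔ Xfer k l [a] s s' := by
  simp only [move1, reaches_seq, reaches_pop, reaches_push, Xfer]
  constructor
  · rintro ⟨s₁, ⟨r, hr, rfl⟩, rfl⟩
    exact ⟨r, hr, by simp [Function.update_of_ne hkl.symm]⟩
  · rintro ⟨r, hr, rfl⟩
    exact ⟨_, ⟨r, hr, rfl⟩, by simp [Function.update_of_ne hkl.symm]⟩

theorem run_move1 {k l : K} (hkl : k ≠ l) {a : A} {s s' : K → List A} (h : Xfer k l [a] s s') :
    (move1 k l a).Run 0 s s' := by
  obtain ⟨r, hr, rfl⟩ := h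
  have := (Run.pop k a 0 s r hr).seq (Run.push l a 0 _)
  rwa [Function.update_of_ne hkl.symm] at this

/-- Move letters with the property `P` from stack `k` to stack `l`, as long as one likes. -/
noncomputable def move [Finite A] (P : A → Prop) (k l : K) : StackProg K A :=
  star (anyOf fun a : {a // P a} => move1 k l a.1)

theorem reaches_move [Finite A] {P : A → Prop} {k l : K} (hkl : k ≠ l) {s s' : K → List A}
    (h : (move P k l).Reaches s s') : ∃ u, (∀ a ∈ u, P a) ∧ Xfer k l u s s' := by
  refine h.star_induction (motive := fun s => ∃ u, (∀ a ∈ u, P a) ∧ Xfer k l u s s')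
    ⟨[], by simp, .nil k l s'⟩ ?_
  rintro s₁ s₂ h ⟨u, hu, hx⟩
  obtain ⟨⟨a, ha⟩, h⟩ := reaches_anyOf.1 h
  refine ⟨[a] ++ u, by simpa using ⟨ha, hu⟩, ((reaches_move1 hkl).1 h).append hkl hx⟩

theorem run_move [Finite A] {P : A → Prop} {k l : K} (hkl : k ≠ l) {u : List A}
    (hu : ∀ a ∈ u, P a) {s s' : K → List A} (h : Xfer k l u s s') :
    (move P k l).Run u.length s s' := by
  induction u generalizing s with
  | nil =>
    obtain ⟨r, hr, rfl⟩ := h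
    obtain rfl : s k = r := hr
    simp only [List.nil_append, List.reverse_nil, Function.update_eq_self]
    exact .starNil _ _ _
  | cons a u ih =>
    obtain ⟨s₁, h₁, h₂⟩ := Xfer.exists_of_append (u := [a]) hkl h
    have := ih (fun b hb => hu b (by simp [hb])) h₂
    have := Run.starCons (Run.anyOf (f := fun a : {a // P a} => move1 k l a.1)
      ⟨a, hu a (by simp)⟩ (run_move1 hkl h₁)) this
    rwa [zero_add] at this

/-- Replace letters `a` on stack `k` by letters `b` on stack `l`. -/
def convert (k : K) (a : A) (l : K) (b : A) : StackProg K A := star (seq (pop k a) (push l b))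

theorem reaches_convert {k l : K} (hkl : k ≠ l) {a b : A} {s s' : K → List A}
    (h : (convert k a l b).Reaches s s') :
    ∃ j r, s k = List.replicate j a ++ r ∧
      s' = Function.update (Function.update s k r) l (List.replicate j b ++ s l) := by
  refine h.star_induction (motive := fun s => ∃ j r, s k = List.replicate j a ++ r ∧
    s' = Function.update (Function.update s k r) l (List.replicate j b ++ s l))
    ⟨0, s' k, by simp, by simp⟩ ?_
  rintro s₁ s₂ h' ⟨j, r, hr, rfl⟩
  obtain ⟨s₃, h₁, h₂⟩ := reaches_seq.1 h'
  obtain ⟨r', hr', rfl⟩ := reaches_pop.1 h₁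
  obtain rfl := reaches_push.1 h₂
  rw [Function.update_of_ne hkl, Function.update_self] at hr
  refine ⟨j + 1, r, by simp [hr', hr, List.replicate_succ], ?_⟩
  funext i
  by_cases hi : i = l
  · subst hi
    simp [List.replicate_succ', hkl.symm]
  · by_cases hk : i = k
    · subst hk
      simp [hi]
    · simp [hi, hk]

theorem run_convert {k l : K} (hkl : k ≠ l) {a b : A} {s : K → List A} {j : ℕ} {r : List A}
    (h : s k = List.replicate j a ++ r) : (convert k a l b).Run j s
      (Function.update (Function.update s k r) l (List.replicate j b ++ s l)) := by
  induction j generalizing s with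
  | zero =>
    obtain rfl : s k = r := h
    simp only [List.nil_append, List.replicate_zero, Function.update_eq_self]
    exact .starNil _ _ _
  | succ j ih =>
    have h₁ := (Run.pop k a 0 s (List.replicate j a ++ r)
      (by simpa [List.replicate_succ] using h)).seq (Run.push l b 0 _)
    have := ih (s := Function.update (Function.update s k (List.replicate j a ++ r)) l
      (b :: Function.update s k (List.replicate j a ++ r) l)) (by
      rw [Function.update_of_ne hkl, Function.update_self])
    have := h₁.starCons this
    rw [zero_add, zero_add] at this
    convert this using 1
    · rfl
    funext i
    by_cases hi : i = l
    · subst hi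
      simp [List.replicate_succ', hkl.symm]
    · by_cases hk : i = k
      · subst hk
        simp [hi]
      · simp [hi, hk]

/-- Remove a common word from the tops of the stacks `k` and `j`, and put it on stack `l`. -/
noncomputable def popBoth [Finite A] (k j l : K) : StackProg K A :=
  star (anyOf fun a : A => seq (pop j a) (move1 k l a))

/-- As the stacks are distinct, removals from `j` commute with moves from `k` to `l`, so the
interleaved loop amounts to one removal followed by one transfer. -/
theorem reaches_popBoth [Finite A] {k j l : K} (hkj : k ≠ j) (hkl : k ≠ l) (hjl : j ≠ l)
    {s s' : K → List A} (h : (popBoth k j l).Reaches s s') :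
    ∃ u r, s j = u ++ r ∧ Xfer k l u (Function.update s j r) s' := by
  refine h.star_induction
    (motive := fun s => ∃ u r, s j = u ++ r ∧ Xfer k l u (Function.update s j r) s')
    ⟨[], s' j, rfl, by simpa using Xfer.nil k l s'⟩ ?_
  rintro s₁ s₂ h ⟨u, r, hr, hx⟩
  obtain ⟨a, h⟩ := reaches_anyOf.1 h
  obtain ⟨s₃, h₁, h₂⟩ := reaches_seq.1 h
  obtain ⟨r₁, hr₁, rfl⟩ := reaches_pop.1 h₁
  obtain ⟨r₂, hr₂, rfl⟩ := (reaches_move1 hkl).1 h₂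
  have : r₁ = u ++ r := by
    rw [← hr, Function.update_of_ne hjl, Function.update_of_ne hkj.symm, Function.update_self]
  subst this
  refine ⟨[a] ++ u, r, by simp [hr₁], Xfer.append hkl (s₁ := _) ⟨r₂, ?_, rfl⟩ ?_⟩
  · rw [Function.update_of_ne hkj] at hr₂ ⊢
    exact hr₂
  · convert hx using 1
    funext i
    by_cases hi : i = j
    · subst hi
      simp [hjl, hkj.symm]
    · by_cases hl : i = l
      · subst hl
        simp [hi]
      · by_cases hk : i = k
        · subst hk; simp [hi, hl]
        · simp [hi, hl, hk]

theorem run_popBoth [Finite A] {k j l : K} (hkj : k ≠ j) (hkl : k ≠ l) (hjl : j ≠ l)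
    {s s' : K → List A} {u r : List A} (hr : s j = u ++ r)
    (h : Xfer k l u (Function.update s j r) s') : (popBoth k j l).Run u.length s s' := by
  induction u generalizing s with
  | nil =>
    obtain ⟨r', hr', rfl⟩ := h
    obtain rfl : s j = r := hr
    obtain rfl : s k = r' := by simpa using hr'
    simp only [List.nil_append, List.reverse_nil, Function.update_eq_self]
    exact .starNil _ _ _
  | cons a u ih =>
    obtain ⟨s₁, ⟨r₁, hr₁, rfl⟩, h₂⟩ := Xfer.exists_of_append (u := [a]) hkl h
    have h₃ := (Run.pop j a 0 s (u ++ r) hr).seq (run_move1 hkl (s' := _)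
      ⟨r₁, by rw [Function.update_of_ne hkj] at hr₁ ⊢; exact hr₁, rfl⟩)
    have := ih (s := Function.update (Function.update (Function.update s j (u ++ r)) k r₁) l
      ([a].reverse ++ Function.update s j (u ++ r) l)) (by
      rw [Function.update_of_ne hjl, Function.update_of_ne hkj.symm, Function.update_self]) (by
      convert h₂ using 1
      funext i
      by_cases hi : i = j
      · subst hi
        simp [hjl, hkj.symm]
      · by_cases hl : i = l
        · subst hl
          simp [hi]
        · by_cases hk : i = k
          · subst hk; simp [hi, hl]
          · simp [hi, hl, hk])
    have := Run.starCons (Run.anyOf (f := fun a : A => seq (pop j a) (move1 k l a)) a h₃) this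
    rwa [zero_add, zero_add] at this

end StackProg

namespace MissingAnswer

open StackProg

variable {Symb : Type} {S : Schema}

instance Letter.finite {Rel : Type} [Finite Symb] [Finite Rel] : Finite (Letter Symb Rel) := by
  refine Finite.of_injective (β := (Symb ⊕ Rel) ⊕ (Bool ⊕ Bool)) (fun a => match a with
    | .sym s => .inl (.inl s)
    | .rel r => .inl (.inr r)
    | .const => .inr (.inl true)
    | .sep => .inr (.inl false)
    | .bit b => .inr (.inr b)) ?_
  rintro (_ | _ | _ | _ | _) (_ | _ | _ | _ | _) h <;> simp_all

instance {Rel : Type} : Inhabited (Letter Symb Rel) := ⟨.sep⟩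

/-- A fact: its relation symbol followed by its tuple of constants. -/
def encFact (f : Fact S) : List (Letter Symb S.Rel) := Letter.rel f.1 :: encTuple f.2

/-- The letters that spell binary words. -/
def Letter.IsBit {Rel : Type} (a : Letter Symb Rel) : Prop := ∃ b, a = .bit b

/-! ### Programs that write or read a fact -/

theorem encFacts_cons (f : Fact S) (F : List (Fact S)) :
    (encFacts (f :: F) : List (Letter Symb S.Rel)) = encFact f ++ encFacts F := rfl

theorem encFacts_append (F G : List (Fact S)) :
    (encFacts (F ++ G) : List (Letter Symb S.Rel)) = encFacts F ++ encFacts G :=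
  List.flatMap_append

theorem encFacts_singleton (f : Fact S) :
    (encFacts [f] : List (Letter Symb S.Rel)) = encFact f := by
  simp [encFacts, encFact]

theorem exists_encBits {u : List (Letter Symb S.Rel)} (hu : ∀ a ∈ u, a.IsBit) :
    ∃ d, u = encBits d := by
  induction u with
  | nil => exact ⟨[], rfl⟩
  | cons a u ih =>
    obtain ⟨b, rfl⟩ := hu a (by simp)
    obtain ⟨d, rfl⟩ := ih fun a ha => hu a (by simp [ha])
    exact ⟨b :: d, rfl⟩

theorem isBit_of_mem_encBits {d : List Bool} {a : Letter Symb S.Rel} (h : a ∈ encBits d) :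
    a.IsBit := by
  obtain ⟨b, -, rfl⟩ := List.mem_map.1 h
  exact ⟨b, rfl⟩

variable {K : Type} [DecidableEq K]

/-- Write an arbitrary constant on stack `l`. -/
noncomputable def genConst (l : K) : StackProg K (Letter Symb S.Rel) :=
  seq (push l .const) (star (anyOf fun b : Bool => push l (.bit b)))

/-- Write an arbitrary fact on stack `l`. -/
noncomputable def genFact (l : K) : StackProg K (Letter Symb S.Rel) :=
  anyOf fun r : S.Rel => seq (push l (.rel r)) (rep (S.arity r) (genConst l))

theorem reaches_genConst {l : K} {s s' : K → List (Letter Symb S.Rel)}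
    (h : (genConst l).Reaches s s') :
    ∃ d, s' = Function.update s l ((encConst d).reverse ++ s l) := by
  obtain ⟨s₁, h₁, h₂⟩ := reaches_seq.1 h
  obtain rfl := reaches_push.1 h₁
  refine h₂.star_invariant
    (motive := fun t => ∃ d, t = Function.update s l ((encConst d).reverse ++ s l))
    ⟨[], rfl⟩ ?_
  rintro s₁ s₂ ⟨d, rfl⟩ h
  obtain ⟨b, h⟩ := reaches_anyOf.1 h
  obtain rfl := reaches_push.1 h
  exact ⟨d ++ [b], by simp [encConst, encBits]⟩

theorem run_genConst (l : K) (s : K → List (Letter Symb S.Rel)) (d : Dom) :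
    (genConst l).Run d.length s (Function.update s l ((encConst d).reverse ++ s l)) := by
  have key : ∀ (d : List Bool) (s : K → List (Letter Symb S.Rel)),
      (star (anyOf fun b : Bool => push l (.bit b))).Run d.length s
        (Function.update s l ((encBits d).reverse ++ s l)) := by
    intro d
    induction d with
    | nil =>
      intro s
      simp only [encBits, List.map_nil, List.reverse_nil, List.nil_append, Function.update_eq_self]
      exact .starNil _ _ _
    | cons b d ih =>
      intro s
      have := Run.starCons (Run.anyOf (f := fun b : Bool => push l (Letter.bit b)) b
        (Run.push l (Letter.bit b) 0 s)) (ih _)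
      rw [zero_add] at this
      simpa [encBits] using this
  have := (Run.push l Letter.const 0 s).seq (key d _)
  rw [zero_add] at this
  unfold genConst
  simpa [encConst] using this

theorem reaches_rep_genConst {l : K} {n : ℕ} {s s' : K → List (Letter Symb S.Rel)}
    (h : (rep n (genConst l)).Reaches s s') :
    ∃ a : Fin n → Dom, s' = Function.update s l ((encTuple a).reverse ++ s l) := by
  induction n generalizing s with
  | zero =>
    obtain rfl := reaches_skip.1 h
    exact ⟨Fin.elim0, by simp [encTuple]⟩
  | succ n ih =>
    obtain ⟨s₁, h₁, h₂⟩ := reaches_seq.1 h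
    obtain ⟨d, rfl⟩ := reaches_genConst h₁
    obtain ⟨a, rfl⟩ := ih h₂
    exact ⟨Fin.cons d a, by simp [encTuple, List.ofFn_succ]⟩

theorem encTuple_succ {n : ℕ} (a : Fin (n + 1) → Dom) :
    (encTuple a : List (Letter Symb S.Rel)) = encConst (a 0) ++ encTuple (Fin.tail a) := by
  simp only [encTuple, List.ofFn_succ, List.flatMap_cons]
  rfl

theorem run_rep_genConst (l : K) {n : ℕ} (s : K → List (Letter Symb S.Rel)) (a : Fin n → Dom) :
    (rep n (genConst l)).Run (encTuple a : List (Letter Symb S.Rel)).length s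
      (Function.update s l ((encTuple a).reverse ++ s l)) := by
  induction n generalizing s with
  | zero =>
    simp only [encTuple, List.ofFn_zero, List.flatMap_nil, List.reverse_nil, List.nil_append,
      Function.update_eq_self]
    exact run_skip _ _
  | succ n ih =>
    have := (run_genConst l s (a 0)).seq (ih _ (Fin.tail a))
    rw [encTuple_succ]
    refine Run.mono (m := _) ?_ (?_ : (a 0).length +
      (encTuple (Fin.tail a) : List (Letter Symb S.Rel)).length ≤ _)
    · rw [rep]
      simpa using this
    · simp [encConst, encBits]

theorem reaches_genFact {l : K} {s s' : K → List (Letter Symb S.Rel)}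
    (h : (genFact l).Reaches s s') :
    ∃ f, s' = Function.update s l ((encFact f).reverse ++ s l) := by
  obtain ⟨r, h⟩ := reaches_anyOf.1 h
  obtain ⟨s₁, h₁, h₂⟩ := reaches_seq.1 h
  obtain rfl := reaches_push.1 h₁
  obtain ⟨a, rfl⟩ := reaches_rep_genConst h₂
  exact ⟨⟨r, a⟩, by simp [encFact]⟩

theorem run_genFact (l : K) (s : K → List (Letter Symb S.Rel)) (f : Fact S) :
    (genFact l).Run (encFact f : List (Letter Symb S.Rel)).length s
      (Function.update s l ((encFact f).reverse ++ s l)) := by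
  have := (Run.push l (Letter.rel f.1) 0 s).seq (run_rep_genConst l _ f.2)
  have := Run.anyOf (f := fun r : S.Rel => seq (push l (Letter.rel r)) (rep (S.arity r) (genConst l)))
    f.1 this
  refine Run.mono (m := _) ?_
    (?_ : 0 + (encTuple f.2 : List (Letter Symb S.Rel)).length ≤ _)
  · unfold genFact
    simpa [encFact] using this
  · simp [encFact]

variable [Finite Symb]

/-- Move a constant from stack `k` to stack `l`. -/
noncomputable def parseConst (k l : K) : StackProg K (Letter Symb S.Rel) :=
  seq (move1 k l .const) (move Letter.IsBit k l)

/-- Move a fact from stack `k` to stack `l`. -/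
noncomputable def parseFact (k l : K) : StackProg K (Letter Symb S.Rel) :=
  anyOf fun r : S.Rel => seq (move1 k l (.rel r)) (rep (S.arity r) (parseConst k l))

variable {k l : K} {s s' : K → List (Letter Symb S.Rel)}

theorem reaches_parseConst (hkl : k ≠ l) (h : (parseConst k l).Reaches s s') :
    ∃ d, Xfer k l (encConst d) s s' := by
  obtain ⟨s₁, h₁, h₂⟩ := reaches_seq.1 h
  obtain ⟨u, hu, h₂⟩ := reaches_move hkl h₂
  obtain ⟨d, rfl⟩ := exists_encBits hu
  exact ⟨d, ((reaches_move1 hkl).1 h₁).append hkl h₂⟩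

theorem run_parseConst (hkl : k ≠ l) {d : Dom} (h : Xfer k l (encConst d) s s') :
    (parseConst k l).Run d.length s s' := by
  obtain ⟨s₁, h₁, h₂⟩ := Xfer.exists_of_append (u := [Letter.const]) (v := encBits d) hkl h
  have := (run_move1 hkl h₁).seq (run_move hkl (fun a ha => isBit_of_mem_encBits ha) h₂)
  unfold parseConst
  simpa [encBits] using this

theorem reaches_rep_parseConst (hkl : k ≠ l) {n : ℕ}
    (h : (rep n (parseConst k l)).Reaches s s') :
    ∃ a : Fin n → Dom, Xfer k l (encTuple a) s s' := by
  induction n generalizing s with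
  | zero =>
    obtain rfl := reaches_skip.1 h
    exact ⟨Fin.elim0, .nil _ _ _⟩
  | succ n ih =>
    obtain ⟨s₁, h₁, h₂⟩ := reaches_seq.1 h
    obtain ⟨d, h₁⟩ := reaches_parseConst hkl h₁
    obtain ⟨a, h₂⟩ := ih h₂
    refine ⟨Fin.cons d a, ?_⟩
    rw [encTuple_succ]
    exact h₁.append hkl h₂

theorem run_rep_parseConst (hkl : k ≠ l) {n : ℕ} {a : Fin n → Dom}
    (h : Xfer k l (encTuple a) s s') :
    (rep n (parseConst k l)).Run (encTuple a : List (Letter Symb S.Rel)).length s s' := by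
  induction n generalizing s with
  | zero =>
    obtain ⟨r, hr, rfl⟩ := h
    obtain rfl : s k = r := hr
    simp only [encTuple, List.ofFn_zero, List.flatMap_nil, List.reverse_nil, List.nil_append,
      Function.update_eq_self]
    exact run_skip _ _
  | succ n ih =>
    rw [encTuple_succ] at h ⊢
    obtain ⟨s₁, h₁, h₂⟩ := Xfer.exists_of_append hkl h
    refine ((run_parseConst hkl h₁).seq (ih h₂)).mono ?_
    simp [encConst, encBits]

theorem reaches_parseFact (hkl : k ≠ l) (h : (parseFact k l).Reaches s s') :
    ∃ f, Xfer k l (encFact f) s s' := by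
  obtain ⟨r, h⟩ := reaches_anyOf.1 h
  obtain ⟨s₁, h₁, h₂⟩ := reaches_seq.1 h
  obtain ⟨a, h₂⟩ := reaches_rep_parseConst hkl h₂
  exact ⟨⟨r, a⟩, ((reaches_move1 hkl).1 h₁).append hkl h₂⟩

theorem run_parseFact (hkl : k ≠ l) {f : Fact S} (h : Xfer k l (encFact f) s s') :
    (parseFact k l).Run (encTuple f.2 : List (Letter Symb S.Rel)).length s s' := by
  obtain ⟨s₁, h₁, h₂⟩ := Xfer.exists_of_append (u := [Letter.rel f.1]) (v := encTuple f.2) hkl h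
  have := (run_move1 hkl h₁).seq (run_rep_parseConst hkl h₂)
  rw [zero_add] at this
  exact this.anyOf (f := fun r : S.Rel => seq (move1 k l (Letter.rel r))
    (rep (S.arity r) (parseConst k l)))

theorem reaches_star_parseFact (hkl : k ≠ l) (h : (star (parseFact k l)).Reaches s s') :
    ∃ F, Xfer k l (encFacts F) s s' := by
  refine h.star_induction (motive := fun s => ∃ F, Xfer k l (encFacts F) s s')
    ⟨[], .nil _ _ _⟩ ?_
  rintro s₁ s₂ h ⟨F, hF⟩
  obtain ⟨f, hf⟩ := reaches_parseFact hkl h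
  exact ⟨f :: F, hf.append hkl hF⟩

theorem run_star_parseFact (hkl : k ≠ l) {F : List (Fact S)} (h : Xfer k l (encFacts F) s s') :
    (star (parseFact k l)).Run (encFacts F : List (Letter Symb S.Rel)).length s s' := by
  induction F generalizing s with
  | nil =>
    obtain ⟨r, hr, rfl⟩ := h
    obtain rfl : s k = r := hr
    simp only [encFacts, List.flatMap_nil, List.reverse_nil, List.nil_append,
      Function.update_eq_self]
    exact .starNil _ _ _
  | cons f F ih =>
    rw [encFacts_cons] at h ⊢
    obtain ⟨s₁, h₁, h₂⟩ := Xfer.exists_of_append hkl h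
    refine ((run_parseFact hkl h₁).starCons (ih h₂)).mono ?_
    simp only [encFact, List.length_append, List.length_cons]
    omega

end MissingAnswer

/-! ### Words made of marked blocks -/

theorem List.append_cons_unique {α : Type*} {P : α → Prop} {u u' v v' : List α} {b b' : α}
    (hu : ∀ a ∈ u, P a) (hu' : ∀ a ∈ u', P a) (hb : ¬ P b) (hb' : ¬ P b')
    (h : u ++ b :: v = u' ++ b' :: v') : u = u' ∧ b = b' ∧ v = v' := by
  induction u generalizing u' with
  | nil =>
    cases u' with
    | nil => simpa using h
    | cons a u' =>
      simp only [List.nil_append, List.cons_append, List.cons.injEq] at h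
      exact absurd (h.1 ▸ hu' a (by simp)) hb
  | cons a u ih =>
    cases u' with
    | nil =>
      simp only [List.nil_append, List.cons_append, List.cons.injEq] at h
      exact absurd (h.1 ▸ hu a (by simp)) hb'
    | cons a' u' =>
      simp only [List.cons_append, List.cons.injEq] at h
      obtain ⟨h₁, h₂, h₃⟩ := ih (fun a ha => hu a (by simp [ha]))
        (fun a ha => hu' a (by simp [ha])) h.2
      exact ⟨by rw [h.1, h₁], h₂, h₃⟩

section Blocks

variable {ι α : Type*} {P : α → Prop} {m : ι → α} {body : ι → List α}

/-- The last block of a sequence of blocks, each of which is a mark followed by letters that are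
not marks, is determined by the word. -/
theorem List.exists_of_reverse_flatMap_eq (hm : ∀ i, ¬ P (m i)) (hb : ∀ i, ∀ a ∈ body i, P a)
    {l : List ι} {u r : List α} {b : α} (hu : ∀ a ∈ u, P a) (hP : ¬ P b)
    (h : (l.flatMap fun i => m i :: body i).reverse = u ++ b :: r) :
    ∃ l' i, l = l' ++ [i] ∧ u = (body i).reverse ∧ b = m i ∧
      r = (l'.flatMap fun i => m i :: body i).reverse := by
  rcases List.eq_nil_or_concat' l with rfl | ⟨l', i, rfl⟩
  · simp at h
  · refine ⟨l', i, rfl, ?_⟩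
    simp only [List.flatMap_append, List.flatMap_cons, List.flatMap_nil, List.append_nil,
      List.reverse_append, List.reverse_cons, List.append_assoc, List.singleton_append] at h
    obtain ⟨h₁, h₂, h₃⟩ := List.append_cons_unique (P := P)
      (fun a ha => hb i a (List.mem_reverse.1 ha)) hu (hm i) hP h
    exact ⟨h₁.symm, h₂.symm, h₃.symm⟩

/-- Peel off blocks from the end: the last mark in the word starts the last block. It is used with
constant marks for tuples and with relation symbols for lists of facts. -/
theorem List.flatMap_blocks_injective (hm : ∀ i, ¬ P (m i)) (hb : ∀ i, ∀ a ∈ body i, P a)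
    (hinj : ∀ i j, m i = m j → body i = body j → i = j) :
    Function.Injective fun l : List ι => l.flatMap fun i => m i :: body i := by
  intro l
  induction l using List.reverseRecOn with
  | nil =>
    intro l' h
    cases l' with
    | nil => rfl
    | cons i l' => simp at h
  | append_singleton l i ih =>
    intro l' h
    have h' := (congrArg List.reverse h).symm
    simp only [List.flatMap_append, List.flatMap_cons, List.flatMap_nil, List.append_nil,
      List.reverse_append, List.reverse_cons, List.append_assoc, List.singleton_append] at h'
    obtain ⟨l'', j, rfl, h₁, h₂, h₃⟩ := List.exists_of_reverse_flatMap_eq hm hb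
      (fun a ha => hb i a (List.mem_reverse.1 ha)) (hm i) h'
    rw [ih (List.reverse_inj.1 h₃), hinj i j h₂ (List.reverse_inj.1 h₁)]

end Blocks

namespace MissingAnswer

open StackProg

variable {Symb : Type} {S : Schema}

/-! ### Unique readability -/

/-- The letters that are not relation symbols. -/
def Letter.NotRel {Rel : Type} (a : Letter Symb Rel) : Prop := ∀ r, a ≠ .rel r

theorem mem_encTuple {n : ℕ} {a : Fin n → Dom} {x : Letter Symb S.Rel} (h : x ∈ encTuple a) :
    x = .const ∨ x.IsBit := by
  obtain ⟨d, -, h⟩ := List.mem_flatMap.1 h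
  rcases List.mem_cons.1 h with h | h
  · exact .inl h
  · exact .inr (isBit_of_mem_encBits h)

theorem notRel_of_mem_encTuple {n : ℕ} {a : Fin n → Dom} {x : Letter Symb S.Rel}
    (h : x ∈ encTuple a) : x.NotRel := by
  rcases mem_encTuple h with rfl | ⟨b, rfl⟩ <;> simp [Letter.NotRel]

theorem not_notRel_rel {r : S.Rel} : ¬ (Letter.rel r : Letter Symb S.Rel).NotRel :=
  fun h => h r rfl

theorem ne_sep_of_mem_encTuple {n : ℕ} {a : Fin n → Dom} {x : Letter Symb S.Rel}
    (h : x ∈ encTuple a) : x ≠ .sep := by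
  rcases mem_encTuple h with rfl | ⟨b, rfl⟩ <;> simp

theorem ne_sep_of_mem_encFacts {F : List (Fact S)} {x : Letter Symb S.Rel}
    (h : x ∈ encFacts F) : x ≠ .sep := by
  obtain ⟨f, -, h⟩ := List.mem_flatMap.1 h
  rcases List.mem_cons.1 h with rfl | h
  · simp
  · exact ne_sep_of_mem_encTuple h

theorem ne_sep_of_mem_encQuery {Q : List (Symb ⊕ Dom)} {x : Letter Symb S.Rel}
    (h : x ∈ encQuery Q) : x ≠ .sep := by
  obtain ⟨q, -, h⟩ := List.mem_flatMap.1 h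
  rcases q with s | d
  · rw [Sum.elim_inl, List.mem_singleton] at h
    simp [h]
  · rcases List.mem_cons.1 h with rfl | h
    · simp
    · obtain ⟨b, rfl⟩ := isBit_of_mem_encBits h
      simp

theorem encTuple_injective {n : ℕ} :
    Function.Injective (encTuple : (Fin n → Dom) → List (Letter Symb S.Rel)) := by
  intro a b h
  refine List.ofFn_injective (List.flatMap_blocks_injective (P := Letter.IsBit)
    (m := fun _ : Dom => (Letter.const : Letter Symb S.Rel)) (body := encBits)
    (fun _ => ?_) (fun _ _ => isBit_of_mem_encBits) (fun d e _ h => ?_) h)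
  · rintro ⟨b, h⟩
    cases h
  · exact List.map_injective_iff.2 (fun b c h => by cases h; rfl) h

theorem eq_of_encTuple_eq {f g : Fact S} (h₁ : f.1 = g.1)
    (h₂ : (encTuple f.2 : List (Letter Symb S.Rel)) = encTuple g.2) : f = g := by
  obtain ⟨r, a⟩ := f
  obtain ⟨r', b⟩ := g
  obtain rfl : r = r' := h₁
  exact congrArg _ (encTuple_injective h₂)

theorem encFacts_injective :
    Function.Injective (encFacts : List (Fact S) → List (Letter Symb S.Rel)) :=
  List.flatMap_blocks_injective (P := Letter.NotRel)
    (m := fun f : Fact S => (Letter.rel f.1 : Letter Symb S.Rel)) (body := fun f => encTuple f.2)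
    (fun _ => not_notRel_rel) (fun _ _ => notRel_of_mem_encTuple)
    (fun _ _ h₁ h₂ => eq_of_encTuple_eq (Letter.rel.inj h₁) h₂)

/-- The last fact of an encoded list of facts. -/
theorem exists_of_reverse_encFacts_eq {F : List (Fact S)} {u v : List (Letter Symb S.Rel)}
    {r : S.Rel} (hu : ∀ a ∈ u, a.NotRel) (h : (encFacts F).reverse = u ++ Letter.rel r :: v) :
    ∃ F' f, F = F' ++ [f] ∧ u ++ [Letter.rel r] = (encFact f).reverse ∧
      v = (encFacts F').reverse := by
  obtain ⟨F', f, rfl, rfl, h₁, rfl⟩ := List.exists_of_reverse_flatMap_eq (P := Letter.NotRel)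
    (m := fun f : Fact S => (Letter.rel f.1 : Letter Symb S.Rel)) (body := fun f => encTuple f.2)
    (fun _ => not_notRel_rel) (fun _ _ => notRel_of_mem_encTuple) hu not_notRel_rel h
  exact ⟨F', f, rfl, by simp [encFact, h₁], rfl⟩

theorem encFact_injective :
    Function.Injective (encFact : Fact S → List (Letter Symb S.Rel)) := by
  intro f g h
  rw [encFact, encFact, List.cons.injEq] at h
  exact eq_of_encTuple_eq (Letter.rel.inj h.1) h.2

/-- Ensures that a literal comparison with the top of a stack of facts removes exactly one complete
fact. -/
theorem exists_of_reverse_encFacts_eq_encFact {F : List (Fact S)} {f : Fact S}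
    {v : List (Letter Symb S.Rel)} (h : (encFacts F).reverse = (encFact f).reverse ++ v) :
    ∃ F', F = F' ++ [f] ∧ v = (encFacts F').reverse := by
  have hf : (encFact f).reverse ++ v =
      (encTuple f.2).reverse ++ (Letter.rel f.1 : Letter Symb S.Rel) :: v := by
    simp [encFact]
  rw [hf] at h
  obtain ⟨F', g, rfl, h₁, h₂⟩ := exists_of_reverse_encFacts_eq
    (fun a ha => notRel_of_mem_encTuple (List.mem_reverse.1 ha)) h
  have : encFact f = (encFact g : List (Letter Symb S.Rel)) := by
    rw [← List.reverse_inj, ← h₁]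
    simp [encFact]
  rw [encFact_injective this]
  exact ⟨F', rfl, h₂⟩

/-! ### Binary numbers -/

/-- The number with binary digits `b`, least significant digit first. -/
def bitsVal (b : List Bool) : ℕ := b.foldr Nat.bit 0

theorem bitsVal_bits (k : ℕ) : bitsVal k.bits = k := by
  induction k using Nat.binaryRec' with
  | zero => rfl
  | bit b n h ih =>
    rw [Nat.bits_append_bit n b h]
    exact congrArg _ ih

/-- The canonical words are those without a leading zero, that is, whose most significant digit, the
last one, is `true`. -/
theorem bits_bitsVal {b : List Bool} (h : b = [] ∨ ∃ c, b = c ++ [true]) :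
    (bitsVal b).bits = b := by
  induction b with
  | nil => rfl
  | cons a b ih =>
    have hb : b = [] ∨ ∃ c, b = c ++ [true] := by
      rcases h with h | ⟨c, h⟩
      · cases h
      · cases c with
        | nil => left; simpa using (List.cons.inj h).2
        | cons x c => exact .inr ⟨c, (List.cons.inj h).2⟩
    have ih := ih hb
    change (Nat.bit a (bitsVal b)).bits = a :: b
    rw [Nat.bits_append_bit, ih]
    intro h0
    rw [h0] at ih
    obtain rfl : [] = b := by simpa using ih
    rcases h with h | ⟨c, h⟩
    · cases h
    · cases c with
      | nil => exact (List.cons.inj h).1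
      | cons x c => simp at h

theorem bits_eq_nil_or (k : ℕ) : k.bits = [] ∨ ∃ c, k.bits = c ++ [true] := by
  induction k using Nat.binaryRec' with
  | zero => left; rfl
  | bit b n h ih =>
    right
    rw [Nat.bits_append_bit n b h]
    rcases ih with ih | ⟨c, ih⟩
    · have : n = 0 := by rw [← bitsVal_bits n, ih]; rfl
      exact ⟨[], by rw [ih, h this]; rfl⟩
    · exact ⟨b :: c, by rw [ih]; rfl⟩

/-- The borrow rule: subtracting one turns the low zeros into ones and the first one into a zero. -/
theorem bitsVal_replicate (j : ℕ) (r : List Bool) :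
    bitsVal (List.replicate j false ++ true :: r) =
      bitsVal (List.replicate j true ++ false :: r) + 1 := by
  induction j with
  | zero => simp [bitsVal, Nat.bit]
  | succ j ih =>
    have h₁ : bitsVal (List.replicate (j + 1) false ++ true :: r) =
      Nat.bit false (bitsVal (List.replicate j false ++ true :: r)) := rfl
    have h₂ : bitsVal (List.replicate (j + 1) true ++ false :: r) =
      Nat.bit true (bitsVal (List.replicate j true ++ false :: r)) := rfl
    rw [h₁, h₂, ih]
    simp only [Nat.bit, cond_true, cond_false]
    omega

theorem exists_eq_replicate_of_bitsVal_pos {b : List Bool} (h : 0 < bitsVal b) :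
    ∃ j r, b = List.replicate j false ++ true :: r := by
  induction b with
  | nil => simp [bitsVal] at h
  | cons a b ih =>
    cases a with
    | true => exact ⟨0, b, rfl⟩
    | false =>
      have : 0 < bitsVal b := by
        have h' : 0 < Nat.bit false (bitsVal b) := h
        simpa [Nat.bit] using h'
      obtain ⟨j, r, rfl⟩ := ih this
      exact ⟨j + 1, r, rfl⟩

theorem bitsVal_lt (b : List Bool) : bitsVal b < 2 ^ b.length := by
  induction b with
  | nil => simp [bitsVal]
  | cons a b ih =>
    change Nat.bit a (bitsVal b) < _
    rw [List.length_cons, pow_succ]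
    cases a <;> simp [Nat.bit] <;> omega

end MissingAnswer

/-! ### Emptying a stack -/

namespace StackProg

variable {K A : Type} [DecidableEq K] [Finite A]

/-- Remove all letters from stack `k`. -/
noncomputable def clear (k : K) : StackProg K A := seq (star (anyOf fun a : A => pop k a)) (empty k)

theorem reaches_clear {k : K} {s s' : K → List A} (h : (clear k).Reaches s s') :
    s' = Function.update s k [] := by
  obtain ⟨s₁, h₁, h₂⟩ := reaches_seq.1 h
  obtain ⟨hk, rfl⟩ := reaches_empty.1 h₂
  have : ∃ r, s' = Function.update s k r := by
    refine h₁.star_invariant (motive := fun t => ∃ r, t = Function.update s k r) ⟨s k, by simp⟩ ?_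
    rintro _ s₂ ⟨r, rfl⟩ h
    obtain ⟨a, h⟩ := reaches_anyOf.1 h
    obtain ⟨l, -, rfl⟩ := reaches_pop.1 h
    exact ⟨l, by simp⟩
  obtain ⟨r, rfl⟩ := this
  rw [Function.update_self] at hk
  rw [hk]

theorem run_clear (k : K) (s : K → List A) :
    (clear k).Run (s k).length s (Function.update s k []) := by
  have key : ∀ u (s : K → List A), s k = u →
      (star (anyOf fun a : A => pop k a)).Run u.length s (Function.update s k []) := by
    intro u
    induction u with
    | nil =>
      intro s hs
      rw [← hs, Function.update_eq_self]
      exact .starNil _ _ _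
    | cons a u ih =>
      intro s hs
      have := Run.starCons (Run.anyOf (f := fun a : A => pop k a) a (Run.pop k a 0 s u hs))
        (ih (Function.update s k u) (by simp))
      rw [zero_add, Function.update_idem] at this
      exact this
  exact (key _ s rfl).seq (Run.empty k 0 _ (by simp))

end StackProg

namespace MissingAnswer

open StackProg

variable {Symb : Type} {S : Schema}

/-! ### The program that guesses an update -/

/-- The stacks of the program. -/
inductive Stk
  | inp | out | facts | rest | tmp | guess | aux
  deriving DecidableEq

instance : Fintype Stk where
  elems := {.inp, .out, .facts, .rest, .tmp, .guess, .aux}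
  complete k := by cases k <;> simp

/-- The stacks with given contents. -/
def layout {A : Type} (i o f y t g x : List A) : Stk → List A
  | .inp => i
  | .out => o
  | .facts => f
  | .rest => y
  | .tmp => t
  | .guess => g
  | .aux => x

section Layout

variable {A : Type} (i o f y t g x l : List A)

@[simp] theorem update_layout_inp :
    Function.update (layout i o f y t g x) .inp l = layout l o f y t g x := by
  funext k; cases k <;> simp [layout]

@[simp] theorem update_layout_out :
    Function.update (layout i o f y t g x) .out l = layout i l f y t g x := by
  funext k; cases k <;> simp [layout]

@[simp] theorem update_layout_facts :
    Function.update (layout i o f y t g x) .facts l = layout i o l y t g x := by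
  funext k; cases k <;> simp [layout]

@[simp] theorem update_layout_rest :
    Function.update (layout i o f y t g x) .rest l = layout i o f l t g x := by
  funext k; cases k <;> simp [layout]

@[simp] theorem update_layout_tmp :
    Function.update (layout i o f y t g x) .tmp l = layout i o f y l g x := by
  funext k; cases k <;> simp [layout]

@[simp] theorem update_layout_guess :
    Function.update (layout i o f y t g x) .guess l = layout i o f y t l x := by
  funext k; cases k <;> simp [layout]

@[simp] theorem update_layout_aux :
    Function.update (layout i o f y t g x) .aux l = layout i o f y t g l := by
  funext k; cases k <;> simp [layout]

theorem update_nil_inp : Function.update (fun _ => []) Stk.inp l = layout l [] [] [] [] [] [] := by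
  funext k; cases k <;> simp [layout]

end Layout

/-- Decrement the binary number on the input stack. -/
def decr : StackProg Stk (Letter Symb S.Rel) :=
  seq (convert .inp (.bit false) .tmp (.bit true)) <|
  seq (pop .inp (.bit true)) <|
  seq (push .inp (.bit false)) <|
  seq (convert .tmp (.bit true) .inp (.bit true)) (empty .tmp)

variable {i o f y t g x : List (Letter Symb S.Rel)} {s : Stk → List (Letter Symb S.Rel)}

theorem exists_of_encBits_eq {b : List Bool} {j : ℕ} {v : List (Letter Symb S.Rel)}
    (h : encBits b = List.replicate j (Letter.bit false) ++ Letter.bit true :: v) :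
    ∃ r, b = List.replicate j false ++ true :: r ∧ v = encBits r := by
  obtain ⟨b₁, b₂, rfl, h₁, h₂⟩ := List.map_eq_append_iff.1 h
  obtain ⟨c, r, rfl, h₃, rfl⟩ := List.map_eq_cons_iff.1 h₂
  refine ⟨r, ?_, rfl⟩
  cases h₃
  congr 1
  have hinj : Function.Injective (Letter.bit : Bool → Letter Symb S.Rel) :=
    fun b c h => Letter.bit.inj h
  refine List.map_injective_iff.2 hinj ?_
  rw [h₁, List.map_replicate]

/-- The loops may stop at will, but if the first one stops before a zero, the pop of a one gets
stuck, and the final emptiness test forces the second to return everything. The result may have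
leading zeros, hence the value of an arbitrary digit word instead of `Nat.bits`. -/
theorem reaches_decr {b : List Bool} (h : decr.Reaches (layout (encBits b) o f y [] g x) s) :
    ∃ b', bitsVal b = bitsVal b' + 1 ∧ s = layout (encBits b') o f y [] g x := by
  obtain ⟨s₁, h₁, h⟩ := reaches_seq.1 h
  obtain ⟨j, r, hr, rfl⟩ := reaches_convert (by decide) h₁
  obtain ⟨s₂, h₂, h⟩ := reaches_seq.1 h
  obtain ⟨r', hr', rfl⟩ := reaches_pop.1 h₂
  obtain ⟨s₃, h₃, h⟩ := reaches_seq.1 h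
  obtain rfl := reaches_push.1 h₃
  obtain ⟨s₄, h₄, h⟩ := reaches_seq.1 h
  obtain ⟨j', r'', hr'', rfl⟩ := reaches_convert (by decide) h₄
  obtain ⟨ht, rfl⟩ := reaches_empty.1 h
  simp only [update_layout_inp, update_layout_tmp, layout, List.append_nil] at hr hr' hr'' ht ⊢
  subst ht
  rw [List.append_nil] at hr''
  obtain rfl : j = j' := by simpa using congrArg List.length hr''
  rw [hr'] at hr
  obtain ⟨c, rfl, rfl⟩ := exists_of_encBits_eq hr
  exact ⟨_, bitsVal_replicate j c, by simp [encBits]⟩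

theorem run_decr {b : List Bool} (hb : 0 < bitsVal b) :
    ∃ b', bitsVal b = bitsVal b' + 1 ∧ b'.length = b.length ∧
      decr.Run (2 * b.length) (layout (encBits b) o f y [] g x)
        (layout (encBits b') o f y [] g x) := by
  obtain ⟨j, r, rfl⟩ := exists_eq_replicate_of_bitsVal_pos hb
  refine ⟨_, bitsVal_replicate j r, by simp, ?_⟩
  have h₁ := run_convert (k := Stk.inp) (l := .tmp) (by decide) (a := Letter.bit false)
    (b := .bit true) (j := j) (r := Letter.bit true :: encBits r)
    (s := layout (encBits (List.replicate j false ++ true :: r)) o f y [] g x)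
    (by simp [layout, encBits])
  simp only [layout, update_layout_inp, update_layout_tmp, List.append_nil] at h₁
  have h₂ := Run.pop Stk.inp (Letter.bit true) 0
    (layout (Letter.bit true :: encBits r) o f y (List.replicate j (Letter.bit true)) g x) _ rfl
  have h₃ := Run.push Stk.inp (Letter.bit false) 0
    (layout (encBits r) o f y (List.replicate j (Letter.bit true)) g x)
  have h₄ := run_convert (k := Stk.tmp) (l := .inp) (by decide) (a := Letter.bit true)
    (b := .bit true) (j := j) (r := [])
    (s := layout (Letter.bit false :: encBits r) o f y (List.replicate j (Letter.bit true)) g x)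
    (by simp [layout])
  have h₅ := Run.empty Stk.tmp 0
    (layout (encBits (List.replicate j true ++ false :: r)) o f y [] g x) rfl
  simp only [layout, update_layout_inp, update_layout_tmp] at h₂ h₃ h₄
  refine (h₁.seq (h₂.seq (h₃.seq (h₄.seq ?_)))).mono (m := j + (0 + (0 + (j + 0)))) ?_
  · simpa [encBits] using h₅
  · simp
    omega

theorem length_encFacts_filter_le (F : List (Fact S)) (d : Fact S) :
    (encFacts (F.filter (· ≠ d)) : List (Letter Symb S.Rel)).length ≤
      (encFacts F : List (Letter Symb S.Rel)).length := by
  induction F with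
  | nil => simp
  | cons f F ih =>
    by_cases hf : f = d
    · simp [hf, encFacts_cons] at ih ⊢
      omega
    · simp [hf, encFacts_cons] at ih ⊢
      omega

variable [Finite Symb]

/-- Move the last fact from stack `facts` to stack `tmp`. -/
noncomputable def keepFact : StackProg Stk (Letter Symb S.Rel) :=
  seq (move Letter.NotRel .facts .tmp) (anyOf fun r : S.Rel => move1 .facts .tmp (.rel r))

/-- Remove the last fact from stack `facts`, provided that it is the one on stack `guess`. -/
noncomputable def dropFact : StackProg Stk (Letter Symb S.Rel) :=
  seq (popBoth .facts .guess .aux) <|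
  seq (empty .guess) <|
  seq (move (fun _ => True) .aux .guess) (empty .aux)

/-- The stack holds the facts reversed, so the topmost relation symbol closes the last fact, and the
moved letters form exactly this fact. -/
theorem reaches_keepFact {F : List (Fact S)}
    (h : keepFact.Reaches (layout i o (encFacts F).reverse y t g x) s) :
    ∃ F' f, F = F' ++ [f] ∧ s = layout i o (encFacts F').reverse y (encFact f ++ t) g x := by
  obtain ⟨s₁, h₁, h⟩ := reaches_seq.1 h
  obtain ⟨u, hu, h₁⟩ := reaches_move (by decide) h₁
  obtain ⟨r, h⟩ := reaches_anyOf.1 h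
  obtain ⟨v, hv, rfl⟩ := h₁.append (by decide) ((reaches_move1 (by decide)).1 h)
  simp only [layout, List.append_assoc, List.singleton_append] at hv
  obtain ⟨F', f, rfl, h₁, rfl⟩ := exists_of_reverse_encFacts_eq hu hv
  exact ⟨F', f, rfl, by rw [h₁]; simp [layout]⟩

theorem run_keepFact (F : List (Fact S)) (f : Fact S) :
    keepFact.Run (encFact f : List (Letter Symb S.Rel)).length
      (layout i o (encFacts (F ++ [f])).reverse y t g x)
      (layout i o (encFacts F).reverse y (encFact f ++ t) g x) := by
  have hx : Xfer .facts .tmp ((encTuple f.2).reverse ++ [Letter.rel f.1])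
      (layout i o (encFacts (F ++ [f])).reverse y t g x)
      (layout i o (encFacts F).reverse y (encFact f ++ t) g x) := by
    refine ⟨(encFacts F).reverse, ?_, ?_⟩
    · simp [layout, encFacts_append, encFacts_singleton, encFact]
    · simp [layout, encFact]
  obtain ⟨s₁, h₁, h₂⟩ := Xfer.exists_of_append (by decide) hx
  have h₃ := run_move (P := Letter.NotRel) (by decide)
    (fun a ha => notRel_of_mem_encTuple (List.mem_reverse.1 ha)) h₁
  have h₄ := Run.anyOf (f := fun r : S.Rel => move1 Stk.facts .tmp (Letter.rel r : Letter Symb S.Rel))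
    f.1 (run_move1 (by decide) h₂)
  refine (h₃.seq h₄).mono ?_
  simp [encFact]

theorem reaches_dropFact {F : List (Fact S)} {d : Fact S}
    (h : dropFact.Reaches (layout i o (encFacts F).reverse y t (encFact d).reverse []) s) :
    ∃ F', F = F' ++ [d] ∧ s = layout i o (encFacts F').reverse y t (encFact d).reverse [] := by
  obtain ⟨s₁, h₁, h⟩ := reaches_seq.1 h
  obtain ⟨u, r, hr, v, hv, rfl⟩ := reaches_popBoth (by decide) (by decide) (by decide) h₁
  obtain ⟨s₂, h₂, h⟩ := reaches_seq.1 h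
  obtain ⟨hr₀, rfl⟩ := reaches_empty.1 h₂
  obtain ⟨s₃, h₃, h⟩ := reaches_seq.1 h
  obtain ⟨u', -, v', hv', rfl⟩ := reaches_move (by decide) h₃
  obtain ⟨hv₀, rfl⟩ := reaches_empty.1 h
  simp only [layout, update_layout_facts, update_layout_guess, update_layout_aux,
    List.append_nil] at hr hv hr₀ hv' hv₀ ⊢
  subst hr₀ hv₀
  rw [List.append_nil] at hr hv'
  subst hr hv'
  obtain ⟨F', rfl, rfl⟩ := exists_of_reverse_encFacts_eq_encFact hv
  exact ⟨F', rfl, by simp⟩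

theorem run_dropFact (F : List (Fact S)) (d : Fact S) :
    dropFact.Run (2 * (encFact d : List (Letter Symb S.Rel)).length)
      (layout i o (encFacts (F ++ [d])).reverse y t (encFact d).reverse [])
      (layout i o (encFacts F).reverse y t (encFact d).reverse []) := by
  have h₁ := run_popBoth (k := Stk.facts) (j := .guess) (l := .aux) (by decide) (by decide)
    (by decide) (u := (encFact d).reverse) (r := [])
    (s := layout i o (encFacts (F ++ [d])).reverse y t (encFact d).reverse [])
    (s' := layout i o (encFacts F).reverse y t [] (encFact d)) (by simp [layout])
    ⟨(encFacts F).reverse, by simp [layout, encFacts_append, encFacts_singleton],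
      by simp [layout]⟩
  have h₂ := Run.empty Stk.guess 0 (layout i o (encFacts F).reverse y t [] (encFact d)) rfl
  have h₃ := run_move (P := fun _ => True) (k := Stk.aux) (l := .guess) (by decide)
    (u := encFact d) (fun _ _ => trivial)
    (s := layout i o (encFacts F).reverse y t [] (encFact d))
    (s' := layout i o (encFacts F).reverse y t (encFact d).reverse [])
    ⟨[], by simp [layout], by simp [layout]⟩
  have h₄ := Run.empty Stk.aux 0
    (layout i o (encFacts F).reverse y t (encFact d).reverse []) rfl
  refine (h₁.seq (h₂.seq (h₃.seq h₄))).mono ?_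
  simp
  omega

/-- Remove some occurrences of some fact from stack `facts`. -/
noncomputable def deleteFact : StackProg Stk (Letter Symb S.Rel) :=
  seq (genFact .guess) <|
  seq (star (alt keepFact dropFact)) <|
  seq (empty .facts) <|
  seq (move (fun _ => True) .tmp .facts) <|
  seq (empty .tmp) (clear .guess)

/-- Occurrences of the guessed fact may be kept or dropped at will, so nothing is claimed about `d`.
For the bound on the symmetric difference it is enough that no other fact is affected. -/
theorem reaches_deleteFact {F : List (Fact S)}
    (h : deleteFact.Reaches (layout i o (encFacts F).reverse y [] [] []) s) :
    ∃ F' d, (∀ f ≠ d, f ∈ F ↔ f ∈ F') ∧ s = layout i o (encFacts F').reverse y [] [] [] := by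
  obtain ⟨s₁, h₁, h⟩ := reaches_seq.1 h
  obtain ⟨d, rfl⟩ := reaches_genFact h₁
  obtain ⟨s₂, h₂, h⟩ := reaches_seq.1 h
  obtain ⟨F₁, F₂, hF, rfl⟩ := h₂.star_invariant
    (motive := fun s => ∃ F₁ F₂, (∀ f ≠ d, f ∈ F ↔ f ∈ F₁ ++ F₂) ∧
      s = layout i o (encFacts F₁).reverse y (encFacts F₂) (encFact d).reverse [])
    ⟨F, [], by simp, by simp [layout, encFacts]⟩ (by
    rintro _ s₂ ⟨F₁, F₂, hF, rfl⟩ h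
    rcases reaches_alt.1 h with h | h
    · obtain ⟨F', f, rfl, rfl⟩ := reaches_keepFact h
      exact ⟨F', f :: F₂, by simpa using hF, rfl⟩
    · obtain ⟨F', rfl, rfl⟩ := reaches_dropFact h
      refine ⟨F', F₂, fun f hf => ?_, rfl⟩
      rw [hF f hf]
      simp [hf])
  obtain ⟨s₃, h₃, h⟩ := reaches_seq.1 h
  obtain ⟨hF₁, rfl⟩ := reaches_empty.1 h₃
  obtain ⟨s₄, h₄, h⟩ := reaches_seq.1 h
  obtain ⟨u, -, v, hv, rfl⟩ := reaches_move (by decide) h₄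
  obtain ⟨s₅, h₅, h⟩ := reaches_seq.1 h
  obtain ⟨hv₀, rfl⟩ := reaches_empty.1 h₅
  obtain rfl := reaches_clear h
  simp only [layout, update_layout_facts, update_layout_guess, update_layout_tmp] at hF₁ hv hv₀ ⊢
  subst hv₀
  rw [List.append_nil] at hv
  subst hv
  obtain rfl : F₁ = [] := by
    cases F₁ with
    | nil => rfl
    | cons a F₁ => simp [encFacts] at hF₁
  exact ⟨F₂, d, by simpa using hF, by simp [hF₁]⟩

theorem run_star_keepFact_dropFact (F F₂ : List (Fact S)) (d : Fact S) :
    (star (alt keepFact dropFact)).Run (3 * (encFacts F : List (Letter Symb S.Rel)).length)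
      (layout i o (encFacts F).reverse y (encFacts F₂) (encFact d).reverse [])
      (layout i o [] y (encFacts (F.filter (· ≠ d) ++ F₂)) (encFact d).reverse []) := by
  induction F using List.reverseRecOn generalizing F₂ with
  | nil => exact .starNil _ _ _
  | append_singleton F f ih =>
    have hlen : (encFacts (F ++ [f]) : List (Letter Symb S.Rel)).length =
        (encFacts F : List (Letter Symb S.Rel)).length +
        (encFact f : List (Letter Symb S.Rel)).length := by
      simp [encFacts_append, encFacts_singleton]
    -- Each fact costs at most twice its length plus one loop entry; since encodings are nonempty,
    -- three times the length covers this.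
    have hpos : 0 < (encFact f : List (Letter Symb S.Rel)).length := by simp [encFact]
    by_cases hf : f = d
    · subst hf
      refine Run.mono ((Run.altr (run_dropFact F f)).starCons (p := alt keepFact dropFact)
        ?_) ?_ (m := _ + 3 * (encFacts F : List (Letter Symb S.Rel)).length + 1)
      · simpa using ih F₂
      · omega
    · refine Run.mono ((Run.altl (run_keepFact F f)).starCons (p := alt keepFact dropFact)
        ?_) ?_ (m := _ + 3 * (encFacts F : List (Letter Symb S.Rel)).length + 1)
      · simpa [hf, encFacts_cons] using ih (f :: F₂)
      · omega

/-- The run drops every occurrence of `d`, since the list may contain repetitions. Writing and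
clearing the guess account for `2 * |d|`, the pass over the facts for `3 * |F|`, moving the
survivors back for at most `|F|`. -/
theorem run_deleteFact (F : List (Fact S)) (d : Fact S) :
    deleteFact.Run (2 * (encFact d : List (Letter Symb S.Rel)).length +
        4 * (encFacts F : List (Letter Symb S.Rel)).length)
      (layout i o (encFacts F).reverse y [] [] [])
      (layout i o (encFacts (F.filter (· ≠ d))).reverse y [] [] []) := by
  have h₁ := run_genFact Stk.guess (layout i o (encFacts F).reverse y [] [] []) d
  have h₂ := run_star_keepFact_dropFact (i := i) (o := o) (y := y) F [] d
  have h₃ := Run.empty Stk.facts 0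
    (layout i o [] y (encFacts (F.filter (· ≠ d))) (encFact d).reverse []) rfl
  have h₄ := run_move (P := fun _ => True) (k := Stk.tmp) (l := .facts) (by decide)
    (u := encFacts (F.filter (· ≠ d))) (fun _ _ => trivial)
    (s := layout i o [] y (encFacts (F.filter (· ≠ d))) (encFact d).reverse [])
    (s' := layout i o (encFacts (F.filter (· ≠ d))).reverse y [] (encFact d).reverse [])
    ⟨[], by simp [layout], by simp [layout]⟩
  have h₅ := Run.empty Stk.tmp 0
    (layout i o (encFacts (F.filter (· ≠ d))).reverse y [] (encFact d).reverse []) rfl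
  have h₆ := run_clear Stk.guess
    (layout i o (encFacts (F.filter (· ≠ d))).reverse y [] (encFact d).reverse [])
  simp only [layout, update_layout_guess, List.append_nil] at h₁ h₂ h₆
  refine (h₁.seq (h₂.seq (h₃.seq (h₄.seq (h₅.seq h₆))))).mono ?_
  have := length_encFacts_filter_le (Symb := Symb) F d
  simp only [List.length_reverse] at this ⊢
  omega

end MissingAnswer

/-! ### Edits and the complete guessing program -/

namespace MissingAnswer

open StackProg

variable {Symb : Type} {S : Schema}

/-- The effect of an insertion (`Sum.inl`) or deletion (`Sum.inr`) on a list of facts. -/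
def applyEdit (F : List (Fact S)) : Fact S ⊕ Fact S → List (Fact S)
  | .inl f => F ++ [f]
  | .inr f => F.filter (· ≠ f)

/-- The fact that is inserted or deleted. -/
def editFact : Fact S ⊕ Fact S → Fact S := Sum.elim id id

theorem length_encFacts_applyEdit (F : List (Fact S)) (e : Fact S ⊕ Fact S) :
    (encFacts (applyEdit F e) : List (Letter Symb S.Rel)).length ≤
      (encFacts F : List (Letter Symb S.Rel)).length +
      (encFact (editFact e) : List (Letter Symb S.Rel)).length := by
  rcases e with f | f
  · simp [applyEdit, editFact, encFacts_append, encFacts_singleton]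
  · exact (length_encFacts_filter_le F f).trans (Nat.le_add_right _ _)

theorem length_encFacts_foldl (E : List (Fact S ⊕ Fact S)) {m : ℕ}
    (hE : ∀ e ∈ E, (encFact (editFact e) : List (Letter Symb S.Rel)).length ≤ m)
    (F : List (Fact S)) :
    (encFacts (E.foldl applyEdit F) : List (Letter Symb S.Rel)).length ≤
      (encFacts F : List (Letter Symb S.Rel)).length + E.length * m := by
  induction E generalizing F with
  | nil => simp
  | cons e E ih =>
    have he := hE e (by simp)
    have hl := length_encFacts_applyEdit (Symb := Symb) F e
    have := ih (fun e he => hE e (by simp [he])) (applyEdit F e)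
    rw [List.foldl_cons, List.length_cons, Nat.succ_mul]
    omega

variable [Finite Symb]

/-- Read the input: the query goes to stack `out`, the facts to stack `facts`, the tuple to stack
`rest`; the bound stays on stack `inp`. -/
noncomputable def parse : StackProg Stk (Letter Symb S.Rel) :=
  seq (move (· ≠ Letter.sep) .inp .out) <|
  seq (move1 .inp .out Letter.sep) <|
  seq (star (parseFact .inp .facts)) <|
  seq (pop .inp Letter.sep) <|
  seq (move (· ≠ Letter.sep) .inp .rest) <|
  seq (pop .inp Letter.sep) <|
  seq (move Letter.IsBit .inp .tmp) <|
  seq (empty .inp) <|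
  -- The digits are reversed on `tmp`, so the most significant one is on top. Words with leading
  -- zeros encode no input and must be rejected here, since the bound is not part of the word handed
  -- to the evaluation machine.
  seq (alt (empty .tmp) (seq (pop .tmp (.bit true)) (push .tmp (.bit true)))) <|
  seq (move Letter.IsBit .tmp .inp) (empty .tmp)

/-- Guess one insertion or deletion and decrease the bound. -/
noncomputable def guessOne : StackProg Stk (Letter Symb S.Rel) :=
  seq decr (alt (genFact .facts) deleteFact)

/-- Write the word for the query, the facts and the tuple on stack `out`. -/
noncomputable def finish : StackProg Stk (Letter Symb S.Rel) :=
  seq (move (fun _ => True) .facts .tmp) <|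
  seq (empty .facts) <|
  seq (move (fun _ => True) .tmp .out) <|
  seq (empty .tmp) <|
  seq (push .out Letter.sep) <|
  seq (move (fun _ => True) .rest .tmp) <|
  seq (empty .rest) <|
  seq (move (fun _ => True) .tmp .out) (empty .tmp)

/-- Replace the instance by a guessed one. -/
noncomputable def guessUpdate : StackProg Stk (Letter Symb S.Rel) :=
  seq parse (seq (star guessOne) finish)

variable {w x y o : List (Letter Symb S.Rel)} {s : Stk → List (Letter Symb S.Rel)}

/-- Only the list of facts and the bound are checked for well-formedness, because they do not reach
the evaluation machine unchanged. Of `x` and `y` it is only known that they contain no separator. -/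
theorem reaches_parse (h : parse.Reaches (layout w [] [] [] [] [] []) s) :
    ∃ (x : List (Letter Symb S.Rel)) (F : List (Fact S)) (y : List (Letter Symb S.Rel)) (k : ℕ),
      (∀ a ∈ x, a ≠ Letter.sep) ∧ (∀ a ∈ y, a ≠ Letter.sep) ∧
      w = x ++ Letter.sep :: (encFacts F ++ Letter.sep :: (y ++ Letter.sep :: encBits k.bits)) ∧
      s = layout (encBits k.bits) (x ++ [Letter.sep]).reverse (encFacts F).reverse y.reverse [] [] [] := by
  unfold parse at h
  rw [reaches_seq] at h
  obtain ⟨_, h', h⟩ := h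
  obtain ⟨x, hx, r₁, hr₁, rfl⟩ := reaches_move (by decide) h'
  clear h'
  obtain rfl : w = x ++ r₁ := hr₁
  simp only [update_layout_inp, update_layout_out] at h
  rw [reaches_seq] at h
  obtain ⟨_, h', h⟩ := h
  obtain ⟨r₂, hr₂, rfl⟩ := (reaches_move1 (by decide)).1 h'
  clear h'
  obtain rfl : r₁ = [Letter.sep] ++ r₂ := hr₂
  simp only [update_layout_inp, update_layout_out] at h
  rw [reaches_seq] at h
  obtain ⟨_, h', h⟩ := h
  obtain ⟨F, r₃, hr₃, rfl⟩ := reaches_star_parseFact (by decide) h'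
  clear h'
  obtain rfl : r₂ = encFacts F ++ r₃ := hr₃
  simp only [update_layout_inp, update_layout_facts] at h
  rw [reaches_seq] at h
  obtain ⟨_, h', h⟩ := h
  obtain ⟨r₄, hr₄, rfl⟩ := reaches_pop.1 h'
  clear h'
  obtain rfl : r₃ = Letter.sep :: r₄ := hr₄
  simp only [update_layout_inp] at h
  rw [reaches_seq] at h
  obtain ⟨_, h', h⟩ := h
  obtain ⟨y, hy, r₅, hr₅, rfl⟩ := reaches_move (by decide) h'
  clear h'
  obtain rfl : r₄ = y ++ r₅ := hr₅
  simp only [update_layout_inp, update_layout_rest] at h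
  rw [reaches_seq] at h
  obtain ⟨_, h', h⟩ := h
  obtain ⟨r₆, hr₆, rfl⟩ := reaches_pop.1 h'
  clear h'
  obtain rfl : r₅ = Letter.sep :: r₆ := hr₆
  simp only [update_layout_inp] at h
  rw [reaches_seq] at h
  obtain ⟨_, h', h⟩ := h
  obtain ⟨u, hu, r₇, hr₇, rfl⟩ := reaches_move (by decide) h'
  clear h'
  obtain rfl : r₆ = u ++ r₇ := hr₇
  obtain ⟨b, rfl⟩ := exists_encBits hu
  simp only [update_layout_inp,
    update_layout_tmp] at h
  rw [reaches_seq] at h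
  obtain ⟨_, h', h⟩ := h
  obtain ⟨h0, rfl⟩ := reaches_empty.1 h'
  clear h'
  obtain rfl : r₇ = [] := h0
  simp only [layout, List.append_nil, List.reverse_singleton, List.singleton_append] at h
  rw [reaches_seq] at h
  obtain ⟨s₉, h₉, h⟩ := h
  have h9 : (b = [] ∨ ∃ c, b = c ++ [true]) ∧ s₉ = layout [] (Letter.sep :: x.reverse)
      (encFacts F).reverse y.reverse (encBits b).reverse [] [] := by
    rcases reaches_alt.1 h₉ with h' | h'
    · obtain ⟨hb, rfl⟩ := reaches_empty.1 h'
      simp only [layout, List.reverse_eq_nil_iff] at hb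
      exact ⟨.inl (by simpa [encBits] using hb), by simp⟩
    · obtain ⟨t, h₁, h₂⟩ := reaches_seq.1 h'
      obtain ⟨l, hl, rfl⟩ := reaches_pop.1 h₁
      obtain rfl := reaches_push.1 h₂
      simp only [layout, update_layout_tmp] at hl ⊢
      refine ⟨.inr ?_, by rw [hl]⟩
      rcases List.eq_nil_or_concat' b with rfl | ⟨c, a, rfl⟩
      · simp [encBits] at hl
      · simp only [encBits, List.map_append, List.map_cons, List.map_nil, List.reverse_append,
          List.reverse_singleton, List.singleton_append, List.cons.injEq, Letter.bit.injEq] at hl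
        exact ⟨c, by rw [hl.1]⟩
  obtain ⟨hb, rfl⟩ := h9
  rw [reaches_seq] at h
  obtain ⟨_, h₁₀, h⟩ := h
  obtain ⟨v, -, r, hr, rfl⟩ := reaches_move (by decide) h₁₀
  obtain ⟨hr0, rfl⟩ := reaches_empty.1 h
  simp only [layout, update_layout_inp, update_layout_tmp, List.append_nil] at hr hr0 ⊢
  subst hr0
  refine ⟨x, F, y, bitsVal b, hx, hy, ?_, ?_⟩
  · simp [bits_bitsVal hb]
  · rw [List.append_nil] at hr
    rw [bits_bitsVal hb, ← hr]
    simp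

theorem run_parse (F : List (Fact S)) (k : ℕ) (hx : ∀ a ∈ x, a ≠ Letter.sep) (hy : ∀ a ∈ y, a ≠ Letter.sep)
    (hw : w = x ++ Letter.sep :: (encFacts F ++ Letter.sep :: (y ++ Letter.sep :: encBits k.bits))) :
    parse.Run (2 * w.length) (layout w [] [] [] [] [] [])
      (layout (encBits k.bits) (x ++ [Letter.sep]).reverse (encFacts F).reverse y.reverse [] [] []) := by
  subst hw
  have hbit : ∀ a ∈ (encBits k.bits : List (Letter Symb S.Rel)), a.IsBit :=
    fun _ => isBit_of_mem_encBits
  have h₁ := run_move (k := Stk.inp) (l := .out) (by decide) hx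
    (s := layout (x ++ Letter.sep ::
      (encFacts F ++ Letter.sep :: (y ++ Letter.sep :: encBits k.bits))) [] [] [] [] [] [])
    ⟨_, rfl, rfl⟩
  have h₂ := run_move1 (k := Stk.inp) (l := .out) (by decide) (a := Letter.sep)
    (s := layout (Letter.sep :: (encFacts F ++ Letter.sep :: (y ++ Letter.sep :: encBits k.bits)))
      (x.reverse ++ []) [] [] [] [] []) ⟨_, rfl, rfl⟩
  have h₃ := run_star_parseFact (k := Stk.inp) (l := .facts) (by decide) (F := F)
    (s := layout (encFacts F ++ Letter.sep :: (y ++ Letter.sep :: encBits k.bits))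
      ([Letter.sep].reverse ++ (x.reverse ++ [])) [] [] [] [] []) ⟨_, rfl, rfl⟩
  have h₄ := Run.pop (Stk.inp) Letter.sep 0 (layout (Letter.sep :: (y ++ Letter.sep :: encBits k.bits))
    ([Letter.sep].reverse ++ (x.reverse ++ [])) ((encFacts F).reverse ++ []) [] [] [] []) _ rfl
  have h₅ := run_move (k := Stk.inp) (l := .rest) (by decide) hy
    (s := layout (y ++ Letter.sep :: encBits k.bits) ([Letter.sep].reverse ++ (x.reverse ++ []))
      ((encFacts F).reverse ++ []) [] [] [] []) ⟨_, rfl, rfl⟩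
  have h₆ := Run.pop (Stk.inp) Letter.sep 0 (layout (Letter.sep :: encBits k.bits)
    ([Letter.sep].reverse ++ (x.reverse ++ [])) ((encFacts F).reverse ++ []) (y.reverse ++ [])
    [] [] []) _ rfl
  have h₇ := run_move (k := Stk.inp) (l := .tmp) (by decide) hbit
    (s := layout (encBits k.bits) ([Letter.sep].reverse ++ (x.reverse ++ []))
      ((encFacts F).reverse ++ []) (y.reverse ++ []) [] [] [])
    ⟨[], by simp [layout], rfl⟩
  have h₈ := Run.empty (Stk.inp) 0 (layout [] ([Letter.sep].reverse ++ (x.reverse ++ []))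
    ((encFacts F).reverse ++ []) (y.reverse ++ [])
    ((encBits k.bits).reverse ++ [] : List (Letter Symb S.Rel)) [] []) rfl
  have h₉ : (alt (empty .tmp) (seq (pop .tmp (.bit true)) (push .tmp (.bit true)))).Run 0
      (layout [] ([Letter.sep].reverse ++ (x.reverse ++ [])) ((encFacts F).reverse ++ [])
        (y.reverse ++ []) ((encBits k.bits).reverse ++ [] : List (Letter Symb S.Rel)) [] [])
      (layout [] ([Letter.sep].reverse ++ (x.reverse ++ [])) ((encFacts F).reverse ++ [])
        (y.reverse ++ []) ((encBits k.bits).reverse ++ [] : List (Letter Symb S.Rel)) [] []) := by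
    rcases bits_eq_nil_or k with h | ⟨c, h⟩
    · refine .altl (Run.empty _ _ _ ?_)
      simp [layout, h, encBits]
    · rw [h]
      have := (Run.pop Stk.tmp (Letter.bit true) 0 (layout [] ([Letter.sep].reverse ++
        (x.reverse ++ [])) ((encFacts F).reverse ++ []) (y.reverse ++ [])
        ((encBits (c ++ [true])).reverse ++ [] : List (Letter Symb S.Rel)) [] [])
        (encBits c).reverse (by simp [layout, encBits])).seq (.push .tmp (.bit true) 0 _)
      refine .altr ?_
      simpa [layout, encBits] using this
  have h₁₀ := run_move (k := Stk.tmp) (l := .inp) (by decide)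
    (u := (encBits k.bits : List (Letter Symb S.Rel)).reverse)
    (fun a ha => hbit a (List.mem_reverse.1 ha))
    (s := layout [] ([Letter.sep].reverse ++ (x.reverse ++ [])) ((encFacts F).reverse ++ [])
      (y.reverse ++ []) ((encBits k.bits).reverse ++ [] : List (Letter Symb S.Rel)) [] [])
    ⟨[], by simp [layout], rfl⟩
  have h₁₁ := Run.empty (Stk.tmp) 0 (layout (encBits k.bits)
    ([Letter.sep].reverse ++ (x.reverse ++ [])) ((encFacts F).reverse ++ [])
    (y.reverse ++ []) ([] : List (Letter Symb S.Rel)) [] []) rfl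
  simp only [layout, update_layout_inp, update_layout_out, update_layout_facts,
    List.append_nil] at h₁ h₂ h₃ h₄
  simp only [layout, update_layout_inp, update_layout_rest, update_layout_tmp,
    List.append_nil] at h₅ h₆ h₇ h₈
  simp only [layout, update_layout_inp, update_layout_tmp, List.append_nil,
    List.reverse_reverse] at h₉ h₁₀ h₁₁
  rw [List.reverse_append]
  refine (h₁.seq (h₂.seq (h₃.seq (h₄.seq (h₅.seq (h₆.seq (h₇.seq (h₈.seq (h₉.seq
    (h₁₀.seq h₁₁)))))))))).mono ?_
  simp
  omega

/-- Both words pass through `tmp`, since a single transfer would reverse them relative to the word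
already on `out`. The emptiness tests make the transfers complete. -/
theorem reaches_finish {F : List (Fact S)} {i : List (Letter Symb S.Rel)}
    (h : finish.Reaches (layout i o (encFacts F).reverse y.reverse [] [] []) s) :
    s .out = (o.reverse ++ (encFacts F ++ Letter.sep :: y)).reverse := by
  unfold finish at h
  rw [reaches_seq] at h
  obtain ⟨_, h', h⟩ := h
  obtain ⟨u₁, -, r₁, hr₁, rfl⟩ := reaches_move (by decide) h'
  clear h'
  simp only [update_layout_facts,
    update_layout_tmp] at h
  simp only [layout, List.append_nil] at h
  rw [reaches_seq] at h
  obtain ⟨_, h', h⟩ := h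
  obtain ⟨e₂, rfl⟩ := reaches_empty.1 h'
  clear h'
  obtain rfl : r₁ = [] := e₂
  rw [List.append_nil] at hr₁
  obtain rfl : (encFacts F).reverse = u₁ := hr₁
  rw [List.reverse_reverse] at h
  rw [reaches_seq] at h
  obtain ⟨_, h', h⟩ := h
  obtain ⟨u₃, -, r₃, hr₃, rfl⟩ := reaches_move (by decide) h'
  clear h'
  simp only [update_layout_out,
    update_layout_tmp] at h
  simp only [layout] at h
  rw [reaches_seq] at h
  obtain ⟨_, h', h⟩ := h
  obtain ⟨e₄, rfl⟩ := reaches_empty.1 h'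
  clear h'
  obtain rfl : r₃ = [] := e₄
  rw [List.append_nil] at hr₃
  obtain rfl : encFacts F = u₃ := hr₃
  rw [reaches_seq] at h
  obtain ⟨_, h', h⟩ := h
  obtain rfl := reaches_push.1 h'
  clear h'
  simp only [update_layout_out] at h
  simp only [layout] at h
  rw [reaches_seq] at h
  obtain ⟨_, h', h⟩ := h
  obtain ⟨u₆, -, r₆, hr₆, rfl⟩ := reaches_move (by decide) h'
  clear h'
  simp only [update_layout_rest,
    update_layout_tmp] at h
  simp only [layout, List.append_nil] at h
  rw [reaches_seq] at h
  obtain ⟨_, h', h⟩ := h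
  obtain ⟨e₇, rfl⟩ := reaches_empty.1 h'
  clear h'
  obtain rfl : r₆ = [] := e₇
  rw [List.append_nil] at hr₆
  obtain rfl : y.reverse = u₆ := hr₆
  rw [List.reverse_reverse] at h
  rw [reaches_seq] at h
  obtain ⟨_, h', h⟩ := h
  obtain ⟨u₈, -, r₈, hr₈, rfl⟩ := reaches_move (by decide) h'
  obtain ⟨e₉, rfl⟩ := reaches_empty.1 h
  simp only [layout, update_layout_out, update_layout_tmp] at hr₈ e₉ ⊢
  subst e₉
  rw [List.append_nil] at hr₈
  subst hr₈
  simp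

theorem run_finish (F : List (Fact S)) (i : List (Letter Symb S.Rel)) :
    finish.Run (2 * (encFacts F : List (Letter Symb S.Rel)).length + 2 * y.length)
      (layout i o (encFacts F).reverse y.reverse [] [] [])
      (layout i (o.reverse ++ (encFacts F ++ Letter.sep :: y)).reverse [] [] [] [] []) := by
  have h₁ := run_move (k := Stk.facts) (l := .tmp) (by decide) (P := fun _ => True)
    (u := (encFacts F : List (Letter Symb S.Rel)).reverse) (fun _ _ => trivial)
    (s := layout i o (encFacts F).reverse y.reverse [] [] []) ⟨[], by simp [layout], rfl⟩
  have h₂ := Run.empty Stk.facts 0 (layout i o [] y.reverse (encFacts F) [] []) rfl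
  have h₃ := run_move (k := Stk.tmp) (l := .out) (by decide) (P := fun _ => True)
    (u := (encFacts F : List (Letter Symb S.Rel))) (fun _ _ => trivial)
    (s := layout i o [] y.reverse (encFacts F) [] []) ⟨[], by simp [layout], rfl⟩
  have h₄ := Run.empty Stk.tmp 0 (layout i ((encFacts F).reverse ++ o) [] y.reverse [] [] []) rfl
  have h₅ := Run.push Stk.out Letter.sep 0
    (layout i ((encFacts F).reverse ++ o) [] y.reverse [] [] [])
  have h₆ := run_move (k := Stk.rest) (l := .tmp) (by decide) (P := fun _ => True)
    (u := y.reverse) (fun _ _ => trivial)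
    (s := layout i (Letter.sep :: ((encFacts F).reverse ++ o)) [] y.reverse [] [] [])
    ⟨[], by simp [layout], rfl⟩
  have h₇ := Run.empty Stk.rest 0
    (layout i (Letter.sep :: ((encFacts F).reverse ++ o)) [] [] y [] []) rfl
  have h₈ := run_move (k := Stk.tmp) (l := .out) (by decide) (P := fun _ => True)
    (u := y) (fun _ _ => trivial)
    (s := layout i (Letter.sep :: ((encFacts F).reverse ++ o)) [] [] y [] [])
    ⟨[], by simp [layout], rfl⟩
  have h₉ := Run.empty Stk.tmp 0
    (layout i (y.reverse ++ Letter.sep :: ((encFacts F).reverse ++ o)) [] [] [] [] []) rfl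
  simp only [layout, update_layout_out, update_layout_facts,
    update_layout_rest, update_layout_tmp, List.append_nil, List.reverse_reverse] at h₁ h₃ h₅ h₆ h₈
  have h := h₁.seq (h₂.seq (h₃.seq (h₄.seq (h₅.seq (h₆.seq (h₇.seq (h₈.seq h₉)))))))
  have ho : y.reverse ++ Letter.sep :: ((encFacts F).reverse ++ o) =
      (o.reverse ++ (encFacts F ++ Letter.sep :: y)).reverse := by simp
  rw [ho] at h
  refine h.mono ?_
  simp only [List.length_reverse]
  omega

theorem reaches_guessUpdate
    (h : guessUpdate.Reaches (Function.update (fun _ => []) Stk.inp w) s) :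
    ∃ (x : List (Letter Symb S.Rel)) (F : List (Fact S)) (y : List (Letter Symb S.Rel)) (k : ℕ)
      (F' : List (Fact S)), (∀ a ∈ x, a ≠ Letter.sep) ∧ (∀ a ∈ y, a ≠ Letter.sep) ∧
      w = x ++ Letter.sep :: (encFacts F ++ Letter.sep :: (y ++ Letter.sep :: encBits k.bits)) ∧
      (symmDiff F.toFinset F'.toFinset).card ≤ k ∧
      (s .out).reverse = x ++ Letter.sep :: (encFacts F' ++ Letter.sep :: y) := by
  rw [update_nil_inp] at h
  obtain ⟨s₁, h₁, h⟩ := reaches_seq.1 h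
  obtain ⟨x, F, y, k, hx, hy, rfl, rfl⟩ := reaches_parse h₁
  obtain ⟨s₂, h₂, h⟩ := reaches_seq.1 h
  -- Loop invariant: the facts changed so far plus the remaining bound do not exceed `k`.
  obtain ⟨b, F', hk, rfl⟩ := h₂.star_invariant
    (motive := fun s => ∃ b F', (symmDiff F.toFinset F'.toFinset).card + bitsVal b ≤ k ∧
      s = layout (encBits b) (x ++ [Letter.sep]).reverse (encFacts F').reverse y.reverse [] [] [])
    ⟨k.bits, F, by simp [bitsVal_bits], rfl⟩ (by
    rintro _ s₂ ⟨b, F', hk, rfl⟩ h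
    obtain ⟨s₃, h₃, h⟩ := reaches_seq.1 h
    obtain ⟨b', hb, rfl⟩ := reaches_decr h₃
    have : ∃ F'' d, (∀ f ≠ d, f ∈ F' ↔ f ∈ F'') ∧
        s₂ = layout (encBits b') (x ++ [Letter.sep]).reverse (encFacts F'').reverse y.reverse
          [] [] [] := by
      rcases reaches_alt.1 h with h | h
      · obtain ⟨d, rfl⟩ := reaches_genFact h
        exact ⟨F' ++ [d], d, fun f hf => by simp [hf],
          by simp [layout, encFacts_append, encFacts_singleton]⟩
      · exact reaches_deleteFact h
    obtain ⟨F'', d, hd, rfl⟩ := this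
    refine ⟨b', F'', ?_, rfl⟩
    -- A round touches only the fact `d`, so at most `d` enters the symmetric difference, while the
    -- bound drops by one.
    have hsub : symmDiff F.toFinset F''.toFinset ⊆
        insert d (symmDiff F.toFinset F'.toFinset) := by
      intro f hf
      by_cases hfd : f = d
      · simp [hfd]
      · simp only [Finset.mem_insert, Finset.mem_symmDiff, List.mem_toFinset] at hf ⊢
        rw [hd f hfd]
        exact .inr hf
    have := (Finset.card_le_card hsub).trans (Finset.card_insert_le _ _)
    omega)
  refine ⟨x, F, y, k, F', hx, hy, rfl, by omega, ?_⟩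
  rw [reaches_finish h]
  simp

theorem run_guessOne {b : List Bool} (hb : 0 < bitsVal b) (F : List (Fact S))
    (e : Fact S ⊕ Fact S) :
    ∃ b', bitsVal b = bitsVal b' + 1 ∧ b'.length = b.length ∧
      guessOne.Run (2 * b.length + 2 * (encFact (editFact e) : List (Letter Symb S.Rel)).length +
          4 * (encFacts F : List (Letter Symb S.Rel)).length)
        (layout (encBits b) o (encFacts F).reverse y [] [] [])
        (layout (encBits b') o (encFacts (applyEdit F e)).reverse y [] [] []) := by
  obtain ⟨b', hb', hlen, hrun⟩ := run_decr (o := o) (f := (encFacts F).reverse) (y := y) (g := [])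
    (x := []) hb
  refine ⟨b', hb', hlen, ?_⟩
  rcases e with f | f
  · have h := run_genFact Stk.facts (layout (encBits b') o (encFacts F).reverse y [] [] []) f
    rw [update_layout_facts] at h
    refine (hrun.seq (.altl (q := deleteFact) (?_ : (genFact Stk.facts).Run
      (encFact f : List (Letter Symb S.Rel)).length _ _))).mono ?_
    · simpa [applyEdit, layout, encFacts_append, encFacts_singleton] using h
    · simp only [editFact, Sum.elim_inl, id]
      omega
  · refine (hrun.seq (.altr (run_deleteFact F f))).mono ?_
    simp only [editFact, Sum.elim_inr, id]
    omega

/-- `B` bounds the length of the counter, of an edited fact and of the list of facts at all times.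
One round then costs at most `2 * B + 2 * B + 4 * B`, plus one for entering the loop body. -/
theorem run_star_guessOne (E : List (Fact S ⊕ Fact S)) {m B : ℕ}
    (hE : ∀ e ∈ E, (encFact (editFact e) : List (Letter Symb S.Rel)).length ≤ m)
    (_hm : m ≤ B) (F : List (Fact S))
    (hF : (encFacts F : List (Letter Symb S.Rel)).length + E.length * m ≤ B)
    {b : List Bool} (hb : E.length ≤ bitsVal b) (hbB : b.length ≤ B) :
    ∃ b', (star guessOne).Run (E.length * (8 * B + 1))
        (layout (encBits b) o (encFacts F).reverse y [] [] [])
        (layout (encBits b') o (encFacts (E.foldl applyEdit F)).reverse y [] [] []) := by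
  induction E generalizing F b with
  | nil => exact ⟨b, .starNil _ _ _⟩
  | cons e E ih =>
    rw [List.length_cons] at hF hb
    have he := hE e (by simp)
    obtain ⟨b₁, hb₁, hlen, hrun⟩ := run_guessOne (o := o) (y := y) (b := b) (by omega) F e
    have hl := length_encFacts_applyEdit (Symb := Symb) F e
    rw [Nat.succ_mul] at hF
    obtain ⟨b', h⟩ := ih (fun e he => hE e (by simp [he])) (applyEdit F e) (by omega)
      (b := b₁) (by omega) (by omega)
    refine ⟨b', (hrun.starCons h).mono ?_⟩
    have : (E.length + 1) * (8 * B + 1) = E.length * (8 * B + 1) + (8 * B + 1) :=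
      Nat.succ_mul _ _
    rw [List.length_cons]
    omega

theorem run_guessUpdate (F : List (Fact S)) (k : ℕ) (hx : ∀ a ∈ x, a ≠ Letter.sep)
    (hy : ∀ a ∈ y, a ≠ Letter.sep)
    (hw : w = x ++ Letter.sep :: (encFacts F ++ Letter.sep :: (y ++ Letter.sep :: encBits k.bits)))
    (E : List (Fact S ⊕ Fact S)) (hk : E.length ≤ k) {m : ℕ}
    (hE : ∀ e ∈ E, (encFact (editFact e) : List (Letter Symb S.Rel)).length ≤ m) :
    ∃ s, guessUpdate.Run ((E.length + 1) * (8 * (w.length + (E.length + 1) * m) + 1))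
        (Function.update (fun _ => []) Stk.inp w) s ∧
      (s .out).reverse = x ++ Letter.sep :: (encFacts (E.foldl applyEdit F) ++ Letter.sep :: y) := by
  have hwl : w.length = x.length + (encFacts F : List (Letter Symb S.Rel)).length + y.length +
      k.bits.length + 3 := by
    rw [hw]
    simp [encBits]
    omega
  have h₁ := run_parse F k hx hy hw
  -- The factor `E.length + 1` in the total cost leaves one extra summand `8 * B + 1`, which pays
  -- for `parse` and `finish`.
  obtain ⟨b', h₂⟩ := run_star_guessOne (o := (x ++ [Letter.sep]).reverse) (y := y.reverse) E hE
    (B := w.length + (E.length + 1) * m) (by nlinarith) F (by nlinarith) (b := k.bits)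
    (by rwa [bitsVal_bits]) (by omega)
  have h₃ := run_finish (o := (x ++ [Letter.sep]).reverse) (y := y) (E.foldl applyEdit F) (encBits b')
  have hl := length_encFacts_foldl E hE F
  rw [update_nil_inp]
  refine ⟨_, (h₁.seq (h₂.seq h₃)).mono ?_, ?_⟩
  · have h₅ : (E.length + 1) * m = E.length * m + m := Nat.succ_mul _ _
    generalize (E.length + 1) * m = c at *
    have h₄ : (E.length + 1) * (8 * (w.length + c) + 1) =
      E.length * (8 * (w.length + c) + 1) + (8 * (w.length + c) + 1) := Nat.succ_mul _ _
    rw [h₄]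
    omega
  · simp [layout]

end MissingAnswer

namespace MissingAnswer

variable {S : Schema}

/-! ### Short repairs -/

theorem Fact.rename_injective {ρ : Dom → Dom} (hρ : Function.Injective ρ) :
    Function.Injective (Fact.rename ρ : Fact S → Fact S) := by
  rintro ⟨r, a⟩ ⟨r', b⟩ h
  obtain ⟨rfl, h⟩ := Sigma.mk.inj_iff.1 h
  have : a = b := hρ.comp_left (eq_of_heq h)
  rw [this]

theorem Fact.rename_eq_self {ρ : Dom → Dom} {f : Fact S} (h : ∀ i, ρ (f.2 i) = f.2 i) :
    Fact.rename ρ f = f := by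
  obtain ⟨r, a⟩ := f
  exact congrArg (Sigma.mk r) (funext h)

theorem Instance.rename_eq_self {ρ : Dom → Dom} {I : Instance S}
    (h : ∀ f ∈ I, ∀ i, ρ (f.2 i) = f.2 i) : Instance.rename ρ I = I := by
  have : Set.EqOn (Fact.rename ρ) id (I : Set (Fact S)) := fun f hf => Fact.rename_eq_self (h f hf)
  rw [Instance.rename, Finset.image_congr this, Finset.image_id]

/-- A permutation of the domain that fixes the constants of length at most `n` and makes the
constants in `N` short. -/
theorem exists_perm_short (N : Finset Dom) {n l : ℕ} (hnl : n < l) (hN : N.card ≤ 2 ^ l) :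
    ∃ ρ : Equiv.Perm Dom, (∀ d, d.length ≤ n → ρ d = d) ∧ ∀ d ∈ N, (ρ d).length ≤ l := by
  classical
  let N' : Finset {d : Dom // n < d.length} := N.subtype _
  have hcard : N'.card ≤ 2 ^ l := by
    rw [Finset.card_subtype]
    exact (Finset.card_filter_le _ _).trans hN
  let x : Fin N'.card ↪ {d : Dom // n < d.length} :=
    N'.equivFin.symm.toEmbedding.trans (Function.Embedding.subtype _)
  -- The targets are words of length exactly `l`; as `n < l`, they are again among the words that
  -- may be moved.
  obtain ⟨z⟩ : Nonempty (Fin N'.card ↪ (Fin l → Bool)) :=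
    Function.Embedding.nonempty_of_card_le (by simpa using hcard)
  let y : Fin N'.card ↪ {d : Dom // n < d.length} :=
    ⟨fun i => ⟨List.ofFn (z i), by simpa using hnl⟩,
      fun i j h => z.injective (List.ofFn_injective (Subtype.ext_iff.1 h))⟩
  -- Multiple transitivity of the symmetric group extends the partial map from `x i` to `y i` to a
  -- permutation of the long words, which is then extended by the identity.
  have := Equiv.Perm.isMultiplyPretransitive {d : Dom // n < d.length} N'.card
  obtain ⟨g, hg⟩ := MulAction.exists_smul_eq (Equiv.Perm {d : Dom // n < d.length}) x y
  refine ⟨Equiv.Perm.ofSubtype g, fun d hd => ?_, fun d hd => ?_⟩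
  · exact Equiv.Perm.ofSubtype_apply_of_not_mem g (by simpa using hd)
  · by_cases hdn : n < d.length
    · have hd' : (⟨d, hdn⟩ : {d : Dom // n < d.length}) ∈ N' := by simpa [N'] using hd
      have h₁ : x (N'.equivFin ⟨_, hd'⟩) = ⟨d, hdn⟩ := by simp [x]
      have h₂ : g ⟨d, hdn⟩ = y (N'.equivFin ⟨_, hd'⟩) := by
        rw [← hg]
        exact (congrArg g h₁).symm
      rw [Equiv.Perm.ofSubtype_apply_of_mem g hdn, h₂]
      exact List.length_ofFn.le
    · rw [Equiv.Perm.ofSubtype_apply_of_not_mem g hdn]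
      omega

/-- If there is a repair, then there is one of at most the same size with short constants. -/
theorem exists_short_repair {L : QueryClass S} (hgen : L.IsGeneric)
    {Q : List (L.Symb ⊕ Dom)} (hQ : Q ∈ L.queries) {I : Instance S}
    {a : Fin (L.arity Q) → Dom} (U : Update I) (hU : L.IsRepair Q a U) {m n : ℕ}
    (hm : ∀ r, S.arity r ≤ m) (hn : U.size ≤ 2 ^ n) (hQn : ∀ d ∈ adom Q, d.length ≤ n)
    (hI : ∀ f ∈ I, ∀ i, (f.2 i).length ≤ n) (ha : ∀ i, (a i).length ≤ n) :
    ∃ V : Update I, L.IsRepair Q a V ∧ V.size ≤ U.size ∧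
      ∀ f ∈ V.ins ∪ V.del, ∀ i, (f.2 i).length ≤ n + m + 1 := by
  let N : Finset Dom := U.ins.biUnion fun f => Finset.univ.image f.2
  -- Only constants of inserted facts need renaming, at most `m` per fact, and `m ≤ 2 ^ m`. The
  -- summand `1` keeps the new length above `n` even when `m = 0`.
  have hN : N.card ≤ 2 ^ (n + m + 1) := by
    calc N.card ≤ U.ins.card * m := Finset.card_biUnion_le_card_mul _ _ _ fun f _ =>
          Finset.card_image_le.trans (by simpa using hm f.1)
      _ ≤ 2 ^ n * 2 ^ m := Nat.mul_le_mul
          ((Finset.card_le_card Finset.subset_union_left).trans hn) Nat.lt_two_pow_self.le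
      _ ≤ 2 ^ (n + m + 1) := by
          rw [← pow_add]
          exact Nat.pow_le_pow_right (by norm_num) (by omega)
  obtain ⟨ρ, hρ, hρN⟩ := exists_perm_short N (n := n) (l := n + m + 1) (by omega) hN
  have hinj : Function.Injective (Fact.rename ρ : Fact S → Fact S) :=
    Fact.rename_injective ρ.injective
  have hIρ : Instance.rename ρ I = I :=
    Instance.rename_eq_self fun f hf i => hρ _ (hI f hf i)
  have hdel : Instance.rename ρ U.del = U.del :=
    Instance.rename_eq_self fun f hf i => hρ _ (hI f (U.del_old hf) i)
  let V : Update I :=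
    { ins := Instance.rename ρ U.ins
      del := U.del
      ins_new := by
        have h := (Finset.disjoint_image hinj).2 U.ins_new
        rwa [show I.image (Fact.rename ρ) = I from hIρ] at h
      del_old := U.del_old }
  -- An injective renaming commutes with union and difference, and it fixes the instance and the
  -- deletions, whose constants all have length at most `n`.
  have hV : V.apply = Instance.rename ρ U.apply := by
    have : Instance.rename ρ U.apply =
        (Instance.rename ρ I ∪ Instance.rename ρ U.ins) \ Instance.rename ρ U.del := by
      simp only [Instance.rename, Update.apply]
      rw [Finset.image_sdiff _ _ hinj, Finset.image_union]
    rw [this, hIρ, hdel]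
    rfl
  refine ⟨V, ?_, ?_, fun f hf i => ?_⟩
  · have haρ : ρ ∘ a = a := funext fun i => hρ _ (ha i)
    have h := hgen Q hQ U.apply ρ fun d hd => hρ d (hQn d hd)
    change a ∈ L.ans Q V.apply
    rw [hV, ← h]
    exact ⟨a, hU, haρ⟩
  · have : V.ins ∪ V.del = Instance.rename ρ (U.ins ∪ U.del) := by
      rw [Instance.rename, Finset.image_union]
      exact congrArg _ hdel.symm
    rw [Update.size, this]
    exact Finset.card_image_le
  · rcases Finset.mem_union.1 hf with hf | hf
    · obtain ⟨g, hg, rfl⟩ := Finset.mem_image.1 hf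
      exact hρN _ (Finset.mem_biUnion.2 ⟨g, hg, Finset.mem_image_of_mem _ (Finset.mem_univ i)⟩)
    · exact (hI f (U.del_old hf) i).trans (by omega)

/-! ### Updates as sequences of edits -/

theorem toFinset_foldl_inl (F D : List (Fact S)) :
    ((D.map Sum.inl).foldl applyEdit F).toFinset = F.toFinset ∪ D.toFinset := by
  induction D generalizing F with
  | nil => simp
  | cons d D ih =>
    rw [List.map_cons, List.foldl_cons, ih]
    ext f
    simp [applyEdit]

theorem toFinset_foldl_inr (F D : List (Fact S)) :
    ((D.map Sum.inr).foldl applyEdit F).toFinset = F.toFinset \ D.toFinset := by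
  induction D generalizing F with
  | nil => simp
  | cons d D ih =>
    rw [List.map_cons, List.foldl_cons, ih]
    ext f
    simp [applyEdit, and_assoc]

/-- Deletions are carried out before insertions; as the two sets are disjoint, the order does not
affect the result. -/
theorem Update.exists_edits {F : List (Fact S)} (U : Update F.toFinset) :
    ∃ E : List (Fact S ⊕ Fact S), E.length = U.size ∧ (∀ e ∈ E, editFact e ∈ U.ins ∪ U.del) ∧
      (E.foldl applyEdit F).toFinset = U.apply := by
  have hd : Disjoint U.ins U.del := U.ins_new.mono_right U.del_old
  refine ⟨U.del.toList.map .inr ++ U.ins.toList.map .inl, ?_, fun e he => ?_, ?_⟩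
  · rw [Update.size, Finset.card_union_of_disjoint hd]
    simp [add_comm]
  · simp only [List.mem_append, List.mem_map, Finset.mem_toList] at he
    rcases he with ⟨f, hf, rfl⟩ | ⟨f, hf, rfl⟩
    · exact Finset.mem_union_right _ hf
    · exact Finset.mem_union_left _ hf
  · rw [List.foldl_append, toFinset_foldl_inl, toFinset_foldl_inr, Finset.toList_toFinset,
      Finset.toList_toFinset, Update.apply, Finset.union_sdiff_distrib,
      Finset.sdiff_eq_self_of_disjoint hd]

/-! ### Lengths of words -/

variable {Symb : Type}

theorem length_le_length_flatMap {α β : Type*} {f : α → List β} {l : List α} {x : α}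
    (h : x ∈ l) : (f x).length ≤ (l.flatMap f).length := by
  induction l with
  | nil => simp at h
  | cons y l ih =>
    rw [List.flatMap_cons, List.length_append]
    rcases List.mem_cons.1 h with rfl | h
    · omega
    · have := ih h
      omega

theorem length_encConst (d : Dom) :
    (encConst d : List (Letter Symb S.Rel)).length = d.length + 1 := by
  simp [encConst, encBits]

theorem length_le_encQuery {Q : List (Symb ⊕ Dom)} {d : Dom} (h : d ∈ adom Q) :
    d.length ≤ (encQuery Q : List (Letter Symb S.Rel)).length := by
  have h' : Sum.inr d ∈ Q := h
  have := length_le_length_flatMap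
    (f := Sum.elim (fun s => [(Letter.sym s : Letter Symb S.Rel)]) encConst) h'
  rw [Sum.elim_inr, length_encConst] at this
  exact (Nat.le_succ _).trans this

theorem length_le_encTuple {n : ℕ} (a : Fin n → Dom) (i : Fin n) :
    (a i).length ≤ (encTuple a : List (Letter Symb S.Rel)).length := by
  have := length_le_length_flatMap (f := (encConst : Dom → List (Letter Symb S.Rel)))
    (List.mem_ofFn.2 ⟨i, rfl⟩ : a i ∈ List.ofFn a)
  rw [length_encConst] at this
  exact (Nat.le_succ _).trans this

theorem length_le_encFacts {F : List (Fact S)} {f : Fact S} (hf : f ∈ F)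
    (i : Fin (S.arity f.1)) :
    (f.2 i).length ≤ (encFacts F : List (Letter Symb S.Rel)).length :=
  ((length_le_encTuple f.2 i).trans (Nat.le_succ _)).trans
    (length_le_length_flatMap (f := fun f : Fact S => (encFact f : List (Letter Symb S.Rel))) hf)

theorem length_encTuple_le {n l : ℕ} {a : Fin n → Dom} (h : ∀ i, (a i).length ≤ l) :
    (encTuple a : List (Letter Symb S.Rel)).length ≤ n * (l + 1) := by
  induction n with
  | zero => simp [encTuple]
  | succ n ih =>
    rw [encTuple_succ, List.length_append, length_encConst, Nat.succ_mul]
    have h₁ := ih (a := Fin.tail a) fun i => h i.succ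
    have h₂ := h 0
    omega

theorem length_encFact_le {f : Fact S} {m l : ℕ} (hm : S.arity f.1 ≤ m)
    (h : ∀ i, (f.2 i).length ≤ l) :
    (encFact f : List (Letter Symb S.Rel)).length ≤ m * (l + 1) + 1 := by
  rw [encFact, List.length_cons]
  exact Nat.succ_le_succ ((length_encTuple_le h).trans (Nat.mul_le_mul_right _ hm))

end MissingAnswer

/-! ### Time bounds -/

/-- A monomial satisfies `a * (2 ^ s) ^ n ≤ 2 ^ (a * s) * 2 ^ (n * s)`, and a sum costs one more
factor `2 ≤ 2 ^ s`; both use `1 ≤ s`. -/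
theorem Polynomial.exists_eval_two_pow_le (r : Polynomial ℕ) :
    ∃ c, ∀ s, 1 ≤ s → r.eval (2 ^ s) ≤ 2 ^ (c * s) := by
  induction r using Polynomial.induction_on' with
  | add p q hp hq =>
    obtain ⟨c, hc⟩ := hp
    obtain ⟨d, hd⟩ := hq
    refine ⟨c + d + 1, fun s hs => ?_⟩
    have h₁ : 2 ^ (c * s) ≤ 2 ^ ((c + d) * s) :=
      Nat.pow_le_pow_right (by norm_num) (Nat.mul_le_mul_right _ (by omega))
    have h₂ : 2 ^ (d * s) ≤ 2 ^ ((c + d) * s) :=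
      Nat.pow_le_pow_right (by norm_num) (Nat.mul_le_mul_right _ (by omega))
    have h₃ : 2 ^ ((c + d) * s) * 2 ≤ 2 ^ ((c + d + 1) * s) := by
      rw [← pow_succ]
      exact Nat.pow_le_pow_right (by norm_num) (by rw [add_mul (c + d) 1]; omega)
    rw [Polynomial.eval_add]
    have := hc s hs
    have := hd s hs
    omega
  | monomial n a =>
    refine ⟨a + n, fun s hs => ?_⟩
    rw [Polynomial.eval_monomial, add_mul, pow_add, ← pow_mul, mul_comm s n]
    refine Nat.mul_le_mul_right _ (Nat.lt_two_pow_self.le.trans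
      (Nat.pow_le_pow_right (by norm_num) (Nat.le_mul_of_pos_right _ hs)))

theorem Polynomial.eval_nat_mono (p : Polynomial ℕ) : Monotone fun n => p.eval n := by
  intro m n h
  simp only [Polynomial.eval_eq_sum_range]
  gcongr

/-- Here `n` is the input length, `e` the number of edits, `v` the length of the guessed word and
`z` the program size. The term `m * (n + m + 1 + 1) + 1` bounds an encoded fact: a relation symbol
and at most `m` marked constants of length at most `n + m + 1`. The summands are the times for
evaluation, copying and guessing. -/
theorem exists_time_bound (p : Polynomial ℕ) (z m : ℕ) :
    ∃ q : Polynomial ℕ, ∀ n e v : ℕ, e < 2 ^ n →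
      v ≤ n + e * (m * (n + m + 1 + 1) + 1) →
      2 ^ p.eval v + v + 1 +
        z * ((e + 1) * (8 * (n + (e + 1) * (m * (n + m + 1 + 1) + 1)) + 1) + 1) ≤
      2 ^ 2 ^ q.eval n := by
  obtain ⟨c, hc⟩ := Polynomial.exists_eval_two_pow_le
    (p + Polynomial.C (10 * z + 2) * Polynomial.X ^ 2 + 1)
  refine ⟨Polynomial.C c * (2 * Polynomial.X + Polynomial.C (2 * m + 2)), fun n e v he hv => ?_⟩
  have hs := hc (2 * n + (2 * m + 2)) (by omega)
  simp only [Polynomial.eval_add, Polynomial.eval_mul, Polynomial.eval_C, Polynomial.eval_pow,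
    Polynomial.eval_X, Polynomial.eval_one, Polynomial.eval_ofNat] at hs ⊢
  set b := m * (n + m + 1 + 1) + 1 with hb
  -- `x` dominates the lengths and counts that occur. The total is then at most `2 ^ r(x)` for the
  -- polynomial `r` to which `hc` applies, and `r(x)` is at most `2` to a linear function of `n`.
  set x := 2 ^ (2 * n + (2 * m + 2)) with hx
  have hb' : b ≤ 2 ^ (n + 2 * m + 1) := by
    have h₁ : n + m + 2 ≤ 2 ^ (n + m + 1) := Nat.lt_two_pow_self
    have h₂ : m + 1 ≤ 2 ^ m := Nat.lt_two_pow_self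
    calc b ≤ (m + 1) * (n + m + 2) := by rw [hb]; nlinarith
      _ ≤ 2 ^ m * 2 ^ (n + m + 1) := Nat.mul_le_mul h₂ h₁
      _ = 2 ^ (n + 2 * m + 1) := by rw [← pow_add]; congr 1; omega
  have hx2 : x = 2 ^ (2 * n + 2 * m + 1) * 2 := by rw [hx, ← pow_succ]; rfl
  have heb : (e + 1) * b ≤ 2 ^ (2 * n + 2 * m + 1) := by
    calc (e + 1) * b ≤ 2 ^ n * 2 ^ (n + 2 * m + 1) := Nat.mul_le_mul he hb'
      _ = 2 ^ (2 * n + 2 * m + 1) := by rw [← pow_add]; congr 1; omega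
  have hn : n ≤ 2 ^ (2 * n + 2 * m + 1) :=
    Nat.lt_two_pow_self.le.trans (Nat.pow_le_pow_right (by norm_num) (by omega))
  have hex : e + 1 ≤ x :=
    le_trans he (by rw [hx]; exact Nat.pow_le_pow_right (by norm_num) (by omega))
  have hsum : n + (e + 1) * b ≤ x := by omega
  have hvx : v ≤ x := by
    have : (e + 1) * b = e * b + b := Nat.succ_mul _ _
    omega
  have hx1 : 1 ≤ x := Nat.one_le_two_pow
  have hpx : 2 ^ p.eval v ≤ 2 ^ p.eval x :=
    Nat.pow_le_pow_right (by norm_num) (p.eval_nat_mono hvx)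
  have hrest : v + 1 + z * ((e + 1) * (8 * (n + (e + 1) * b) + 1) + 1) ≤
      (10 * z + 2) * x ^ 2 := by
    have h₁ : (e + 1) * (8 * (n + (e + 1) * b) + 1) + 1 ≤ 10 * x ^ 2 := by
      calc (e + 1) * (8 * (n + (e + 1) * b) + 1) + 1 ≤ x * (8 * x + 1) + 1 := by gcongr
        _ ≤ 10 * x ^ 2 := by nlinarith
    calc v + 1 + z * ((e + 1) * (8 * (n + (e + 1) * b) + 1) + 1)
        ≤ x + 1 + z * (10 * x ^ 2) := by gcongr
      _ ≤ (10 * z + 2) * x ^ 2 := by nlinarith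
  set y := (10 * z + 2) * x ^ 2
  calc 2 ^ p.eval v + v + 1 + z * ((e + 1) * (8 * (n + (e + 1) * b) + 1) + 1)
      ≤ 2 ^ p.eval x + y := by omega
    _ ≤ 2 ^ (p.eval x + y + 1) := by
      have h₁ : 2 ^ p.eval x ≤ 2 ^ (p.eval x + y) := Nat.pow_le_pow_right (by norm_num) (by omega)
      have h₂ : y ≤ 2 ^ (p.eval x + y) :=
        Nat.lt_two_pow_self.le.trans (Nat.pow_le_pow_right (by norm_num) (by omega))
      rw [pow_succ]
      omega
    _ ≤ _ := Nat.pow_le_pow_right (by norm_num) hs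

/-! ### The bounded missing answer problem -/

namespace MissingAnswer

open StackProg

theorem QueryClass.maBound_mem_twoNEXP {S : Schema} (L : QueryClass S) (hgen : L.IsGeneric)
    (hEval : L.Eval ∈ NEXP) : L.MABound ∈ TwoNEXP := by
  have := L.finSymb
  obtain ⟨p, M, hsound, hcomplete⟩ := hEval
  obtain ⟨N, hN₁, hN₂⟩ :=
    M.exists_prepend (guessUpdate : StackProg Stk (Letter L.Symb S.Rel)) .inp .out
  let m := Finset.univ.sup S.arity
  have hm : ∀ r, S.arity r ≤ m := fun r => Finset.le_sup (Finset.mem_univ r)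
  obtain ⟨q, hq⟩ := exists_time_bound p
    (guessUpdate : StackProg Stk (Letter L.Symb S.Rel)).size m
  refine ⟨q, N, fun w t ht => ?_, ?_⟩
  · obtain ⟨n, s, t', hrun, hM⟩ := hN₁ w t ht
    obtain ⟨x, F, y, k, F', hx, hy, rfl, hk, hs⟩ := reaches_guessUpdate hrun.reaches
    -- Acceptance certifies that the guessed word is a well-formed evaluation input. Comparing the
    -- parts before each separator identifies `x` with the query, `F'` with the facts and `y` with
    -- the tuple.
    obtain ⟨Q, hQ, F'', a, hw, ha⟩ := hsound _ _ hM
    rw [hs, encEvalInput] at hw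
    obtain ⟨rfl, -, hw⟩ := List.append_cons_unique (P := (· ≠ Letter.sep)) hx
      (fun _ => ne_sep_of_mem_encQuery) (by simp) (by simp) hw
    obtain ⟨hF, -, rfl⟩ := List.append_cons_unique (P := (· ≠ Letter.sep))
      (fun _ => ne_sep_of_mem_encFacts) (fun _ => ne_sep_of_mem_encFacts) (by simp) (by simp) hw
    obtain rfl := encFacts_injective hF
    -- The edits made by the run may be redundant or undo each other; the update is read off from
    -- the difference of the two instances, and its size is that of their symmetric difference.
    let U : Update F.toFinset :=
      { ins := F'.toFinset \ F.toFinset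
        del := F.toFinset \ F'.toFinset
        ins_new := Finset.sdiff_disjoint
        del_old := Finset.sdiff_subset }
    have hU : U.apply = F'.toFinset := by
      ext f
      simp only [Update.apply, U, Finset.mem_sdiff, Finset.mem_union]
      tauto
    refine ⟨Q, hQ, F, a, k, ?_, U, ?_, ?_⟩
    · simp [encMAInput, encEvalInput]
    · rw [QueryClass.IsRepair, hU]
      exact ha
    · rw [symmDiff_comm] at hk
      exact hk
  · rintro w ⟨Q, hQ, F, a, k, rfl, U, hU, hk⟩
    set w : List (Letter L.Symb S.Rel) := encMAInput Q F a k with hw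
    have hw' : w = encQuery Q ++ Letter.sep :: (encFacts F ++ Letter.sep ::
        (encTuple a ++ Letter.sep :: encBits k.bits)) := by
      simp [hw, encMAInput, encEvalInput]
    have hlen : w.length = (encQuery Q : List (Letter L.Symb S.Rel)).length +
        (encFacts F : List (Letter L.Symb S.Rel)).length +
        (encTuple a : List (Letter L.Symb S.Rel)).length + k.bits.length + 3 := by
      rw [hw']
      simp [encBits]
      omega
    have hk2 : k < 2 ^ w.length := by
      have := bitsVal_lt k.bits
      rw [bitsVal_bits] at this
      exact this.trans_le (Nat.pow_le_pow_right (by norm_num) (by omega))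
    -- The input length serves both as a bound on all given constants and as an exponent for the
    -- size of the repair.
    obtain ⟨V, hV, hVU, hshort⟩ := exists_short_repair hgen hQ U hU (n := w.length) hm
      ((hk.trans_lt hk2).le)
      (fun d hd => (length_le_encQuery (Symb := L.Symb) (S := S) hd).trans (by omega))
      (fun f hf i => (length_le_encFacts (Symb := L.Symb) (List.mem_toFinset.1 hf) i).trans
        (by omega))
      (fun i => (length_le_encTuple (Symb := L.Symb) (S := S) a i).trans (by omega))
    obtain ⟨E, hE, hmem, happ⟩ := V.exists_edits
    have hEk : E.length ≤ k := by omega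
    have hEm : ∀ e ∈ E, (encFact (editFact e) : List (Letter L.Symb S.Rel)).length ≤
        m * (w.length + m + 1 + 1) + 1 :=
      fun e he => length_encFact_le (hm _) (hshort _ (hmem e he))
    obtain ⟨s, hrun, hs⟩ := run_guessUpdate F k (fun _ => ne_sep_of_mem_encQuery)
      (fun _ => ne_sep_of_mem_encTuple) hw' E hEk hEm
    have hEv : (s .out).reverse ∈ L.Eval := by
      refine ⟨Q, hQ, E.foldl applyEdit F, a, hs, ?_⟩
      rw [happ]
      exact hV
    obtain ⟨t, ht, hacc⟩ := hcomplete _ hEv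
    obtain ⟨t', ht', hacc'⟩ := hN₂ w _ s t hrun hacc
    refine ⟨t', ht'.trans ?_, hacc'⟩
    have hsl := congrArg List.length hs
    have hfold := length_encFacts_foldl E hEm F
    rw [List.length_reverse] at ht hsl
    simp only [List.length_append, List.length_cons] at hsl
    refine le_trans ?_ (hq w.length E.length (s .out).length (by omega) (by omega))
    gcongr

end MissingAnswer

theorem mainTheorem10 (S : MissingAnswer.Schema) (L : MissingAnswer.QueryClass S)
    (hgen : L.IsGeneric) (hEval : L.Eval ∈ NEXP) : L.MABound ∈ TwoNEXP :=
  L.maBound_mem_twoNEXP hgen hEval
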